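/- All rings are commutative. A ring homomorphism $R\to B$ is called \emph{fppf} if it is faithfully flat and of finite presentation. A ring is \emph{strictly local} if it is a henselian local ring with separably closed residue field. A ring $R$ is \emph{fppf-local} if it is local and every fppf homomorphism $R\to B$ admits a retraction, that is, an $R$-algebra homomorphism $B\to R$. For a ring $R$, let $I(R)$ be a set of finite fppf $R$-algebras with connected spectrum that contains exactly one representative of each isomorphism class of such algebras. For a finite subset $\varphi\subset I(R)$ put $A_\varphi=\bigotimes_{A\in\varphi}A$ (tensor product over $R$), and let $R_+=\varinjlim_\varphi A_\varphi$ be the filtered direct limit over all finite subsets $\varphi$ of $I(R)$, ordered by inclusion, the transition map $A_\varphi\to A_\psi$ for $\varphi\subset\psi$ inserting $1$ in the factors from $\psi\smallsetminus\varphi$. By transfinite recursion, define a direct system of rings $R_\nu$, indexed by the ordinals $\nu$ of a universe containing $R$: $R_0=R$; $R_{\gamma+1}=(R_\gamma)_+$, with the canonical map $R_\gamma\to (R_\gamma)_+$ as transition map; and $R_\nu=\varinjlim_{\gamma<\nu}R_\gamma$ if $\nu$ is a limit ordinal. \textbf{Theorem.} Let $R$ be a strictly local ring. Then every ring $R_\nu$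 is strictly local, and for all ordinals $\gamma\le\nu$ the transition map $R_\gamma\to R_\nu$ is local, faithfully flat and integral. Moreover, for each limit ordinal $\lambda$ (in particular $\lambda\neq 0$), the ring $R_\lambda$ is fppf-local. -/

import Mathlib

universe u v w w'

noncomputable section

namespace FppfTower

open CategoryTheory CategoryTheory.Limits
open scoped TensorProduct

/-- Strictly local rings: henselian local rings with separably closed residue field. -/
class IsStrictlyLocal (R : Type u) [CommRing R] : Prop extends HenselianLocalRing R where
  isSepClosed : IsSepClosed (IsLocalRing.ResidueField R)

/-- The algebra `B` is fppf over `R`: faithfully flat and of finite presentation. -/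
structure IsFppf (R : Type u) (B : Type v) [CommRing R] [CommRing B] [Algebra R B] : Prop where
  faithfullyFlat : Module.FaithfullyFlat R B
  finitePresentation : Algebra.FinitePresentation R B

/-- A ring is fppf-local if it is local and every fppf homomorphism `R → B` admits a retraction.
Every algebra of finite presentation over `R : Type u` is isomorphic to one in `Type u`. -/
structure IsFppfLocal (R : Type u) [CommRing R] : Prop where
  isLocalRing : IsLocalRing R
  exists_retraction : ∀ (B : Type u) [CommRing B] [Algebra R B], IsFppf R B → Nonempty (B →ₐ[R] R)

section Plus

variable (R : Type u) [CommRing R]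

/-- The objects of the category `ℱ(R)`: finite fppf `R`-algebras `A` with `Spec A` connected
(in particular non-empty). -/
structure IsConnectedFiniteFppf (A : Type v) [CommRing A] [Algebra R A] : Prop where
  finite : Module.Finite R A
  isFppf : IsFppf R A
  connectedSpace : ConnectedSpace (PrimeSpectrum A)

/-- Finite presentations of `R`-algebras: a number `n` of variables and finitely many polynomials
in these variables. -/
abbrev Pres : Type u := Σ n : ℕ, Finset (MvPolynomial (Fin n) R)

variable {R} in
/-- The `R`-algebra `R[T₁, …, Tₙ] / (f₁, …, fᵣ)` given by a presentation. -/
abbrev Pres.Alg (p : Pres R) : Type u :=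
  MvPolynomial (Fin p.1) R ⧸ Ideal.span (p.2 : Set (MvPolynomial (Fin p.1) R))

/-- Isomorphism of the presented algebras, on the presentations of objects of `ℱ(R)`. -/
def presSetoid : Setoid {p : Pres R // IsConnectedFiniteFppf R p.Alg} where
  r p q := Nonempty (p.1.Alg ≃ₐ[R] q.1.Alg)
  iseqv := ⟨fun _ ↦ ⟨AlgEquiv.refl⟩, fun ⟨e⟩ ↦ ⟨e.symm⟩, fun ⟨e⟩ ⟨e'⟩ ↦ ⟨e.trans e'⟩⟩

/-- The index set `I(R)` of isomorphism classes of objects of `ℱ(R)`. -/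
def Idx : Type u := Quotient (presSetoid R)

variable {R} in
/-- The chosen representative of an isomorphism class of objects of `ℱ(R)`. -/
abbrev Idx.Alg (i : Idx R) : Type u := (Quotient.out (s := presSetoid R) i).1.Alg

variable {R} in
lemma Idx.isConnectedFiniteFppf (i : Idx R) : IsConnectedFiniteFppf R i.Alg :=
  (Quotient.out (s := presSetoid R) i).2

/-- Every object of `ℱ(R)` is isomorphic to precisely one of the chosen representatives. -/
lemma existsUnique_idx (A : Type v) [CommRing A] [Algebra R A] (hA : IsConnectedFiniteFppf R A) :
    ∃! i : Idx R, Nonempty (A ≃ₐ[R] i.Alg) := by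
  obtain ⟨n, f, hf, s, hs⟩ := hA.isFppf.finitePresentation
  have e : Pres.Alg (⟨n, s⟩ : Pres R) ≃ₐ[R] A :=
    (Ideal.quotientEquivAlgOfEq R hs).trans (Ideal.quotientKerAlgEquivOfSurjective hf)
  have hp : IsConnectedFiniteFppf R (Pres.Alg (⟨n, s⟩ : Pres R)) := by
    have := hA.finite
    have := hA.isFppf.faithfullyFlat
    have := hA.isFppf.finitePresentation
    have := hA.connectedSpace
    exact ⟨Module.Finite.equiv e.symm.toLinearEquiv,
      ⟨Module.FaithfullyFlat.of_linearEquiv R A e.toLinearEquiv,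
        Algebra.FinitePresentation.equiv e.symm⟩,
      (PrimeSpectrum.homeomorphOfRingEquiv e.symm.toRingEquiv).surjective.connectedSpace
        (PrimeSpectrum.homeomorphOfRingEquiv e.symm.toRingEquiv).continuous⟩
  refine ⟨Quotient.mk (presSetoid R) ⟨_, hp⟩, ?_, ?_⟩
  · obtain ⟨e'⟩ := Quotient.mk_out (s := presSetoid R) ⟨_, hp⟩
    exact ⟨e.symm.trans e'.symm⟩
  · rintro j ⟨e'⟩
    rw [← Quotient.out_eq (s := presSetoid R) j]
    exact Quotient.sound (s := presSetoid R) ⟨(e.trans e').symm⟩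

/-- The tensor product `A_φ = ⨂_{A ∈ φ} A` over `R` of the algebras in a finite subset `φ ⊆ I(R)`
(no ordering of `φ` is involved). -/
abbrev Tens (φ : Finset (Idx R)) : Type u := ⨂[R] i : φ, i.1.Alg

open scoped Classical in
/-- The transition map `A_φ → A_ψ` for `φ ⊆ ψ`; it sends `⊗_{i ∈ φ} aᵢ` to the product of the images
of the `aᵢ` under the canonical maps `Aᵢ → A_ψ`, that is, it inserts `1` in the other places. -/
def tensMap {φ ψ : Finset (Idx R)} (h : φ ≤ ψ) : Tens R φ →ₐ[R] Tens R ψ :=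
  PiTensorProduct.liftAlgHom
    ((MultilinearMap.mkPiAlgebra R φ (Tens R ψ)).compLinearMap fun i ↦
      (PiTensorProduct.singleAlgHom (R := R) (A := fun j : ψ ↦ j.1.Alg) ⟨i.1, h i.2⟩).toLinearMap)
    (by
      simp only [MultilinearMap.compLinearMap_apply, MultilinearMap.mkPiAlgebra_apply,
        Pi.one_apply, AlgHom.toLinearMap_apply, map_one, Finset.prod_const_one])
    (fun x y ↦ by
      simp only [MultilinearMap.compLinearMap_apply, MultilinearMap.mkPiAlgebra_apply,
        Pi.mul_apply, AlgHom.toLinearMap_apply, map_mul, Finset.prod_mul_distrib])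

open scoped Classical in
lemma tensMap_single {φ ψ : Finset (Idx R)} (h : φ ≤ ψ) (i : φ) (a : i.1.Alg) :
    tensMap R h (PiTensorProduct.singleAlgHom (R := R) (A := fun j : φ ↦ j.1.Alg) i a) =
      PiTensorProduct.singleAlgHom (R := R) (A := fun j : ψ ↦ j.1.Alg) ⟨i.1, h i.2⟩ a := by
  change PiTensorProduct.lift _ (PiTensorProduct.tprod R
    (MonoidHom.mulSingle (fun j : φ ↦ j.1.Alg) i a)) = _
  rw [PiTensorProduct.lift.tprod]
  simp only [MultilinearMap.compLinearMap_apply, MultilinearMap.mkPiAlgebra_apply,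
    AlgHom.toLinearMap_apply]
  rw [Finset.prod_eq_single i]
  · simp
  · intro j _ hj
    rw [MonoidHom.mulSingle_apply, Pi.mulSingle_eq_of_ne hj, map_one]
  · simp

open scoped Classical in
instance : DirectedSystem (Tens R) (fun _ _ h ↦ tensMap R h) where
  map_self φ x := by
    have : tensMap R (le_refl φ) = AlgHom.id R _ :=
      PiTensorProduct.algHom_ext fun i ↦ AlgHom.ext fun a ↦ by
        simp only [AlgHom.comp_apply, tensMap_single, AlgHom.id_apply]
    exact DFunLike.congr_fun this x
  map_map φ ψ χ h h' x := by
    have : (tensMap R h').comp (tensMap R h) = tensMap R (h.trans h') :=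
      PiTensorProduct.algHom_ext fun i ↦ AlgHom.ext fun a ↦ by
        simp only [AlgHom.comp_apply, tensMap_single]
    exact DFunLike.congr_fun this x

/-- The ring `R₊`: the filtered direct limit of the `A_φ` over all finite subsets `φ ⊆ I(R)`. -/
def Plus : Type u := DirectLimit (Tens R) (fun _ _ h ↦ tensMap R h)

instance : CommRing (Plus R) :=
  inferInstanceAs (CommRing (DirectLimit (Tens R) (fun _ _ h ↦ tensMap R h)))

instance : Algebra R (Plus R) :=
  inferInstanceAs (Algebra R (DirectLimit (Tens R) (fun _ _ h ↦ tensMap R h)))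

/-- The canonical map `A_φ → R₊`. -/
def Plus.of (φ : Finset (Idx R)) : Tens R φ →ₐ[R] Plus R :=
  DirectLimit.Algebra.of (Tens R) (fun _ _ h ↦ tensMap R h) φ

end Plus

section Recursion

variable {J : Type w} [LinearOrder J] {C : Type w'} [Category.{v} C]

/-- Auxiliary data for the transfinite recursion: an object with maps from other objects. -/
structure Stage (J : Type w) (C : Type w') [Category.{v} C] where
  /-- the object -/
  pt : C
  /-- the sources of the maps -/
  src : J → C
  /-- the maps -/
  map (a : J) : src a ⟶ pt

/-- The data at the indices in `s` form a functor on `s`. -/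
structure Compat (s : Set J) (D : s → Stage J C) : Prop where
  src_eq : ∀ {a b : s}, a ≤ b → (D b).src a = (D a).pt
  map_id : ∀ a : s, eqToHom (src_eq (le_refl a)).symm ≫ (D a).map a = 𝟙 _
  map_comp : ∀ {a b c : s} (hab : a ≤ b) (hbc : b ≤ c),
    eqToHom (src_eq (hab.trans hbc)).symm ≫ (D c).map a =
      (eqToHom (src_eq hab).symm ≫ (D b).map a) ≫ (eqToHom (src_eq hbc).symm ≫ (D c).map b)

/-- The functor given by compatible data. -/
def Compat.functor {s : Set J} {D : s → Stage J C} (h : Compat s D) : s ⥤ C where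
  obj a := (D a).pt
  map {a b} f := eqToHom (h.src_eq (leOfHom f)).symm ≫ (D b).map a
  map_id a := h.map_id a
  map_comp f g := h.map_comp (leOfHom f) (leOfHom g)

variable (E : ∀ (j : J) (F : Set.Iio j ⥤ C), Cocone F)

/-- The data at `j` obtained from compatible data below `j`. -/
def Compat.next {j : J} {D : Set.Iio j → Stage J C} (h : Compat (Set.Iio j) D) : Stage J C where
  pt := (E j h.functor).pt
  src a := if ha : a < j then (D ⟨a, ha⟩).pt else (E j h.functor).pt
  map a := if ha : a < j then eqToHom (dif_pos ha) ≫ (E j h.functor).ι.app ⟨a, ha⟩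
    else eqToHom (dif_neg ha)

lemma Compat.next_spec_lt {j : J} {D : Set.Iio j → Stage J C} (h : Compat (Set.Iio j) D)
    {S : Stage J C} (hS : S = h.next E) {a : J} (ha : a < j) :
    ∃ (h₁ : S.src a = (D ⟨a, ha⟩).pt) (h₂ : (E j h.functor).pt = S.pt),
      S.map a = eqToHom h₁ ≫ (E j h.functor).ι.app ⟨a, ha⟩ ≫ eqToHom h₂ := by
  subst hS
  refine ⟨dif_pos ha, rfl, (dif_pos ha).trans ?_⟩
  exact congrArg (fun f ↦ eqToHom _ ≫ f) (Category.comp_id _).symm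

lemma Compat.next_spec_self {j : J} {D : Set.Iio j → Stage J C} (h : Compat (Set.Iio j) D)
    {S : Stage J C} (hS : S = h.next E) :
    ∃ (h₁ : S.src j = S.pt), S.map j = eqToHom h₁ := by
  subst hS
  exact ⟨dif_neg (lt_irrefl j), by simp [Compat.next]⟩

lemma compat_of_next (s : Set J) (hs : ∀ j ∈ s, ∀ a < j, a ∈ s) (D : s → Stage J C)
    (H : ∀ j : s, ∃ h : Compat (Set.Iio j.1) (fun a ↦ D ⟨a.1, hs j.1 j.2 a.1 a.2⟩),
      D j = h.next E) : Compat s D := by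
  have src_eq : ∀ {a b : s}, a ≤ b → (D b).src a = (D a).pt := by
    intro a b hab
    obtain ⟨h, hb⟩ := H b
    rcases hab.lt_or_eq with hlt | rfl
    · exact (h.next_spec_lt E hb hlt).1
    · exact (h.next_spec_self E hb).1
  have map_id : ∀ a : s, eqToHom (src_eq (le_refl a)).symm ≫ (D a).map a = 𝟙 _ := by
    intro a
    obtain ⟨h, ha⟩ := H a
    obtain ⟨h₁, h₂⟩ := h.next_spec_self E ha
    rw [h₂]; simp
  refine ⟨src_eq, map_id, ?_⟩
  intro a b c hab hbc
  rcases hab.lt_or_eq with hab' | rfl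
  · rcases hbc.lt_or_eq with hbc' | rfl
    · obtain ⟨h, hc⟩ := H c
      obtain ⟨h₁, h₂, h₃⟩ := h.next_spec_lt E hc (hab'.trans hbc')
      obtain ⟨h₁', h₂', h₃'⟩ := h.next_spec_lt E hc hbc'
      have nat := (E c.1 h.functor).w
        (homOfLE hab : (⟨a.1, hab'.trans hbc'⟩ : Set.Iio c.1) ⟶ ⟨b.1, hbc'⟩)
      rw [h₃, h₃', ← nat]
      simp [Compat.functor]
    · rw [map_id, Category.comp_id]
  · rw [map_id, Category.id_comp]

lemma cocone_eq {K : Type*} [Category* K] {F : K ⥤ C} {c c' : Cocone F} (h : c.pt = c'.pt)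
    (h' : ∀ a, c.ι.app a ≫ eqToHom h = c'.ι.app a) : c = c' := by
  obtain ⟨X, f⟩ := c
  obtain ⟨Y, g⟩ := c'
  obtain rfl : X = Y := h
  congr 1
  ext a
  simpa using h' a

/-- Transfinite recursion for functors on a well-ordered set: if for each `j` every functor `F` on
the predecessors of `j` is assigned a cocone `E j F`, then there is a functor `T` on the whole
well-ordered set whose value at each `j`, with the maps from the earlier values, is the cocone
assigned to the restriction of `T` to the predecessors of `j`. -/
theorem exists_functor_cocone_eq [WellFoundedLT J] [Nonempty C] :
    ∃ T : J ⥤ C, ∀ j : J, (Set.principalSegIio j).cocone T =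
      E j ((Set.principalSegIio j).monotone.functor ⋙ T) := by
  classical
  obtain ⟨X⟩ := ‹Nonempty C›
  let step (j : J) (D : ∀ a, a < j → Stage J C) : Stage J C :=
    if h : Compat (Set.Iio j) (fun a ↦ D a.1 a.2) then h.next E else ⟨X, fun _ ↦ X, fun _ ↦ 𝟙 X⟩
  let G : J → Stage J C := (wellFounded_lt (α := J)).fix step
  have hG (j : J) : G j = step j (fun a _ ↦ G a) := WellFounded.fix_eq _ _ _
  have key (j : J) : Compat (Set.Iio j) (fun a ↦ G a.1) := by
    induction j using WellFoundedLT.induction with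
    | ind j ih =>
      refine compat_of_next E _ (fun k hk a ha ↦ lt_trans ha hk) _ fun k ↦ ⟨ih k.1 k.2, ?_⟩
      rw [hG k.1]
      exact dif_pos (ih k.1 k.2)
  have hG' (j : J) : G j = (key j).next E := by
    rw [hG j]
    exact dif_pos (key j)
  have top : Compat Set.univ (fun a ↦ G a.1) :=
    compat_of_next E _ (fun _ _ _ _ ↦ trivial) _ fun k ↦ ⟨key k.1, hG' k.1⟩
  let I : J ⥤ (Set.univ : Set J) :=
    { obj j := ⟨j, trivial⟩
      map f := homOfLE (leOfHom f) }
  refine ⟨I ⋙ top.functor, fun j ↦ ?_⟩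
  change _ = E j (key j).functor
  refine cocone_eq (congrArg Stage.pt (hG' j)) fun a ↦ ?_
  obtain ⟨h₁, h₂, h₃⟩ := (key j).next_spec_lt E (hG' j) a.2
  change (eqToHom _ ≫ (G j).map a.1) ≫ eqToHom _ = _
  rw [h₃]
  have aux {A A' B B' : C} (p : A = A') (q : A' = A) (f : A ⟶ B) (r : B = B') (t : B' = B) :
      (eqToHom p ≫ eqToHom q ≫ f ≫ eqToHom r) ≫ eqToHom t = f := by
    subst p r; simp
  exact aux _ _ ((E j (key j).functor).ι.app a) _ _

end Recursion

section Tower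

/-- The map `R → R₊` as a morphism. -/
def toPlus (A : CommRingCat.{u}) : A ⟶ CommRingCat.of (Plus A) :=
  CommRingCat.ofHom (algebraMap A (Plus A))

/-- The ring `R` under the empty system. -/
def zeroCocone (R : Type u) [CommRing R] {ν : Ordinal.{u}} (h : ν = 0)
    (F : Set.Iio ν ⥤ CommRingCat.{u}) : Cocone F where
  pt := CommRingCat.of R
  ι :=
    { app := fun a ↦ (not_lt_zero (a.2.trans_eq h)).elim
      naturality := fun a ↦ (not_lt_zero (a.2.trans_eq h)).elim }

/-- The index `γ` is the last one below `γ + 1`. -/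
def isTerminalOfSucc {ν : Ordinal.{u}} (γ : Set.Iio ν) (h : ν = Order.succ γ.1) : IsTerminal γ :=
  IsTerminal.ofUniqueHom (fun a ↦ homOfLE (Order.lt_succ_iff.mp (a.2.trans_eq h) : a.1 ≤ γ.1))
    (fun _ _ ↦ Subsingleton.elim _ _)

/-- The ring `(F γ)₊` under a system `F` with last index `γ`, with the maps
`F a → F γ → (F γ)₊`. -/
def succCocone {ν : Ordinal.{u}} (γ : Set.Iio ν) (h : ν = Order.succ γ.1)
    (F : Set.Iio ν ⥤ CommRingCat.{u}) : Cocone F :=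
  (coconeOfDiagramTerminal (isTerminalOfSucc γ h) F).extend (toPlus (F.obj γ))

instance (ν : Ordinal.{u}) : HasColimitsOfShape (Set.Iio ν) CommRingCat.{u} :=
  hasColimitsOfShape_of_essentiallySmall.{u} _ _

open scoped Classical in
/-- One step of the transfinite recursion. Given the rings `F γ = R_γ` for `γ < ν` with their
transition maps, this is the ring `R_ν` with the maps `R_γ → R_ν`: it is `R` for `ν = 0`, the ring
`(R_γ)₊` for a successor ordinal `ν = γ + 1`, and the direct limit of all `R_γ`, `γ < ν`, for a
limit ordinal `ν`. -/
def towerStep (R : Type u) [CommRing R] (ν : Ordinal.{u}) (F : Set.Iio ν ⥤ CommRingCat.{u}) :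
    Cocone F :=
  if h₀ : ν = 0 then zeroCocone R h₀ F
  else if h₁ : ∃ γ : Set.Iio ν, ν = Order.succ γ.1 then succCocone h₁.choose h₁.choose_spec F
  else colimit.cocone F

/-- The direct system of the rings `R_ν`, indexed by all ordinals `ν` of the universe of `R`. -/
def tower (R : Type u) [CommRing R] : Ordinal.{u} ⥤ CommRingCat.{u} :=
  (exists_functor_cocone_eq (towerStep R)).choose

lemma tower_spec (R : Type u) [CommRing R] (ν : Ordinal.{u}) :
    (Set.principalSegIio ν).cocone (tower R) =
      towerStep R ν ((Set.principalSegIio ν).monotone.functor ⋙ tower R) :=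
  (exists_functor_cocone_eq (towerStep R)).choose_spec ν

/-- The ring `R_ν`. -/
abbrev stage (R : Type u) [CommRing R] (ν : Ordinal.{u}) : Type u := (tower R).obj ν

/-- The transition map `R_γ → R_ν` for `γ ≤ ν`. -/
abbrev transition (R : Type u) [CommRing R] {γ ν : Ordinal.{u}} (h : γ ≤ ν) :
    stage R γ →+* stage R ν := ((tower R).map (homOfLE h)).hom

/-- `R_0 = R`. -/
lemma tower_zero (R : Type u) [CommRing R] : (tower R).obj 0 = CommRingCat.of R := by
  have h := congrArg Cocone.pt (tower_spec R 0)
  rw [towerStep, dif_pos rfl] at h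
  exact h

/-- `R_{γ+1} = (R_γ)₊`, and the transition map is the canonical map `R_γ → (R_γ)₊`. -/
lemma tower_succ (R : Type u) [CommRing R] (γ : Ordinal.{u}) :
    ∃ e : (tower R).obj (Order.succ γ) ≅ CommRingCat.of (Plus ((tower R).obj γ)),
      (tower R).map (homOfLE (Order.le_succ γ)) ≫ e.hom = toPlus ((tower R).obj γ) := by
  have h := tower_spec R (Order.succ γ)
  have hex : ∃ δ : Set.Iio (Order.succ γ), Order.succ γ = Order.succ δ.1 :=
    ⟨⟨γ, Order.lt_succ γ⟩, rfl⟩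
  rw [towerStep, dif_neg (show ¬ Order.succ γ = 0 from Order.succ_ne_bot γ), dif_pos hex] at h
  have congr {δ δ' : Set.Iio (Order.succ γ)} (hδ : δ = δ') (h₁ : Order.succ γ = Order.succ δ.1)
      (h₂ : Order.succ γ = Order.succ δ'.1) (F : Set.Iio (Order.succ γ) ⥤ CommRingCat.{u}) :
      succCocone δ h₁ F = succCocone δ' h₂ F := by
    subst hδ
    rfl
  replace h := h.trans (congr (δ' := ⟨γ, Order.lt_succ γ⟩)
    (Subtype.ext (Order.succ_injective hex.choose_spec.symm)) _ rfl _)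
  have aux {K : Type (u + 1)} [Category.{u + 1} K] {F : K ⥤ CommRingCat.{u}} {c c' : Cocone F}
      (h : c = c') (a : K) : ∃ e : c.pt ≅ c'.pt, c.ι.app a ≫ e.hom = c'.ι.app a := by
    subst h
    exact ⟨Iso.refl _, Category.comp_id _⟩
  obtain ⟨e, he⟩ := aux h ⟨γ, Order.lt_succ γ⟩
  refine ⟨e, he.trans ?_⟩
  change (tower R).map (𝟙 γ) ≫ toPlus _ = _
  rw [(tower R).map_id]
  exact Category.id_comp _

/-- For a limit ordinal `ν`, the ring `R_ν` is the direct limit of the `R_γ`, `γ < ν`. -/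
lemma tower_limit (R : Type u) [CommRing R] (ν : Ordinal.{u}) (hν : Order.IsSuccLimit ν) :
    Nonempty (IsColimit ((Set.principalSegIio ν).cocone (tower R))) := by
  rw [tower_spec, towerStep, dif_neg (by rintro rfl; exact hν.not_isMin isMin_bot), dif_neg]
  · exact ⟨colimit.isColimit _⟩
  · rintro ⟨γ, h⟩
    rw [h] at hν
    exact Order.not_isSuccLimit_succ γ.1 hν

end Tower

end FppfTower

end

/-! Fppf-locality at a limit ordinal λ is a small object argument. An fppf algebra B over R_λ has a
finite presentation, whose coefficients all come from some R_γ with γ < λ. So B is the base change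
of an R_γ-algebra M, which is fppf by descent along the faithfully flat map R_γ → R_λ. A map from M
to (R_γ)₊ ≅ R_{γ+1}, followed by R_{γ+1} → R_λ, yields the retraction of B.

This needs two facts about a strictly local ring R with residue field k. The first is that every
fppf algebra B maps to R₊ (`nonempty_algHom_plus`). Noether normalization of the closed fibre lifts
to a map R[X₁,…,Xₙ] → B. As k is infinite, the closed fibre is free over k[X₁,…,Xₙ] at some rational
point. At a prime above that point B is quasi-finite over R[X₁,…,Xₙ], so over an étale neighbourhood
a finite piece splits off, and this piece is free near the point by the fibre criterion
(`free_of_flat_of_flat_fibre`). Evaluation at a lift of the point extends to the étale neighbourhood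
because R is henselian, and it turns the piece into a nonzero finite free R-algebra receiving B
(`exists_algHom_finite_free`). A local factor of that algebra is isomorphic to one of the factors of
R₊.

The second is that R₊ is strictly local, integral and flat over R. Finite algebras with connected
spectrum over R are local, with residue field purely inseparable over k; this forces R₊ to have a
single maximal ideal (`Plus.isLocalRing`). A local ring integral over R is henselian
(`henselianLocalRing_of_isIntegral`), and its residue field, being algebraic over k, is separably
closed. Flatness, integrality and locality pass to direct limits, hence hold along the tower. An
integral map of local rings is local, and a flat local map is faithfully flat. -/

namespace FppfTower

open scoped TensorProduct

/-! ### Henselian local rings: lifting étale points and splitting finite algebras. -/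

section Henselian

open Polynomial IsLocalRing

/-- Points of étale algebras with values in the residue field of a henselian local ring lift. -/
theorem exists_lift_of_etale {P : Type u} {S : Type v} {P' : Type w} [CommRing P] [CommRing S]
    [HenselianLocalRing S] [Algebra P S] [CommRing P'] [Algebra P P'] [Algebra.Etale P P']
    (ψ : P' →ₐ[P] ResidueField S) :
    ∃ σ : P' →ₐ[P] S, ∀ x, residue S (σ x) = ψ x := by
  let Q : Ideal P' := RingHom.ker ψ
  have : Q.IsPrime := RingHom.ker_isPrime _
  -- Around the kernel of `ψ` the étale algebra is given by one monic polynomial with invertible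
  -- derivative, so lifting `ψ` amounts to Hensel's lemma for a simple root.
  obtain ⟨f, hfQ, ⟨⟨E⟩⟩⟩ := Algebra.IsEtaleAt.exists_isStandardEtale (R := P) Q
  have hf : IsUnit (ψ f) := isUnit_iff_ne_zero.mpr hfQ
  let ψ' : Localization.Away f →ₐ[P] ResidueField S :=
    IsLocalization.liftAlgHom (M := Submonoid.powers f) (f := ψ) (by
      rintro ⟨_, n, rfl⟩
      simpa using hf.pow n)
  have hψ' (x : P') : ψ' (algebraMap _ _ x) = ψ x := by simp [ψ']
  have hmap : E.P.HasMap (ψ' E.x) := E.hasMap.map ψ'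
  obtain ⟨a₀, ha₀⟩ := residue_surjective (ψ' E.x)
  have hres (p : P[X]) : residue S ((p.map (algebraMap P S)).eval a₀) = aeval (ψ' E.x) p := by
    rw [← ha₀, eval_map, aeval_def, hom_eval₂]
    rfl
  obtain ⟨a, hroot, haa₀⟩ := HenselianLocalRing.is_henselian (E.f.map (algebraMap P S))
    (E.monic_f.map _) a₀ (by
      rw [← residue_eq_zero_iff, hres]
      exact hmap.1) (by
      rw [← isUnit_map_iff (residue S), derivative_map, hres]
      exact hmap.isUnit_derivative_f)
  have hres_a : residue S a = ψ' E.x := by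
    rw [← ha₀, ← sub_eq_zero, ← map_sub, residue_eq_zero_iff]
    exact haa₀
  have hresa (p : P[X]) : residue S (aeval a p) = aeval (ψ' E.x) p := by
    rw [← hres_a, aeval_def, aeval_def, hom_eval₂]
    rfl
  have hmapa : E.P.HasMap a := by
    refine ⟨?_, ?_⟩
    · rwa [IsRoot, eval_map] at hroot
    · rw [← isUnit_map_iff (residue S), hresa]
      exact hmap.2
  let τ : Localization.Away f →ₐ[P] S := (E.P.lift a hmapa).comp E.equivRing
  refine ⟨τ.comp (IsScalarTower.toAlgHom P P' (Localization.Away f)), fun x ↦ ?_⟩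
  have key : (IsScalarTower.toAlgHom P S (ResidueField S)).comp τ = ψ' := by
    refine E.hom_ext ?_
    change residue S (τ E.x) = _
    simp [τ, hres_a, E.equivRing_x]
  rw [← hψ']
  exact DFunLike.congr_fun key _

/-- Lifting property of étale neighbourhoods without residue field extension. -/
theorem exists_lift_of_etale_of_bijective {P : Type u} {S : Type v} {P' : Type w}
    [CommRing P] [CommRing S]
    [HenselianLocalRing S] [Algebra P S] [CommRing P'] [Algebra P P'] [Algebra.Etale P P']
    (p : Ideal P) [p.IsPrime] (hp : (maximalIdeal S).comap (algebraMap P S) = p)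
    (p' : Ideal P') [p'.IsPrime] [p'.LiesOver p]
    (hb : Function.Bijective (Ideal.ResidueField.mapₐ p p' (Algebra.ofId _ _) (p'.over_def p))) :
    ∃ σ : P' →ₐ[P] S, (maximalIdeal S).comap σ = p' := by
  let e := AlgEquiv.ofBijective _ hb
  let l : p.ResidueField →ₐ[P] ResidueField S :=
    Ideal.ResidueField.liftₐ p (Algebra.ofId P (ResidueField S))
      (fun x hx ↦ by
        rw [← hp] at hx
        rw [RingHom.mem_ker]
        exact (residue_eq_zero_iff _).mpr hx)
      (by
        intro x hx
        rw [Submonoid.mem_comap, IsUnit.mem_submonoid_iff]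
        have hx' : algebraMap P S x ∉ maximalIdeal S := fun h ↦ hx (hp ▸ h)
        exact (isUnit_map_iff (residue S) _).mpr (notMem_maximalIdeal.mp hx'))
  -- As the residue extension is trivial, this is P' → κ(p') ≅ κ(p) → κ(S), with kernel `p'`.
  let ψ : P' →ₐ[P] ResidueField S :=
    (l.comp (e.symm.toAlgHom.restrictScalars P)).comp (IsScalarTower.toAlgHom P P' p'.ResidueField)
  obtain ⟨σ, hσ⟩ := exists_lift_of_etale ψ
  refine ⟨σ, ?_⟩
  ext x
  rw [Ideal.mem_comap, ← residue_eq_zero_iff]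
  erw [hσ x]
  simp [ψ]


/-- A finite algebra over a henselian local ring splits off its localization at each maximal
ideal. -/
theorem exists_isIdempotentElem_of_finite {R : Type u} {A : Type v} [CommRing R]
    [HenselianLocalRing R] [CommRing A] [Algebra R A] [Module.Finite R A] (q : Ideal A) [q.IsPrime]
    [q.LiesOver (maximalIdeal R)] :
    ∃ e : A, IsIdempotentElem e ∧ e ∉ q ∧
      ∀ Q : Ideal A, Q.IsPrime → Q.LiesOver (maximalIdeal R) → e ∉ Q → Q = q := by
  obtain ⟨R', _, _, _, P, _, _, e, he, P', _, _, hP'q, heP', hb, -, H⟩ :=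
    Algebra.exists_etale_isIdempotentElem_forall_liesOver_eq (maximalIdeal R) q
  obtain ⟨σ, hσ⟩ := exists_lift_of_etale_of_bijective (S := R) (maximalIdeal R)
    (Ideal.comap_id _) P hb
  -- `σ` retracts `R → R'`, so `φ` carries the idempotent `e` from the étale neighbourhood back to
  -- `A`. Since σ⁻¹(𝔪) = `P`, each r is congruent to σ(r) modulo `P`; hence `φ` pulls `q` back to
  -- `P'`.
  let φ : R' ⊗[R] A →ₐ[R] A := Algebra.TensorProduct.lift ((Algebra.ofId R A).comp σ)
    (AlgHom.id R A) (fun _ _ ↦ Commute.all _ _)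
  have hφ (x : R' ⊗[R] A) : x - 1 ⊗ₜ φ x ∈ P' := by
    induction x with
    | zero => simp
    | add x y hx hy =>
      rw [map_add, TensorProduct.tmul_add, add_sub_add_comm]
      exact add_mem hx hy
    | tmul r a =>
      have h₁ : r ⊗ₜ[R] a - 1 ⊗ₜ φ (r ⊗ₜ a) =
          algebraMap R' (R' ⊗[R] A) (r - algebraMap R R' (σ r)) * (1 ⊗ₜ a) := by
        have : φ (r ⊗ₜ a) = σ r • a := by simp [φ, Algebra.smul_def, Algebra.ofId_apply]
        rw [this, TensorProduct.tmul_smul, TensorProduct.smul_tmul', map_sub, sub_mul]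
        simp [Algebra.smul_def]
      rw [h₁]
      refine Ideal.mul_mem_right _ _ ?_
      rw [← Ideal.mem_comap, ← Ideal.under_def, ← P'.over_def P, ← hσ, Ideal.mem_comap]
      simp
  have hφP' : q.comap φ = P' := by
    ext x
    rw [Ideal.mem_comap, ← hP'q, Ideal.mem_comap]
    exact ⟨fun h ↦ by simpa using add_mem (hφ x) h, fun h ↦ by simpa using sub_mem h (hφ x)⟩
  refine ⟨φ e, he.map φ, fun h ↦ heP' (hφP' ▸ h), fun Q _ hQ heQ ↦ ?_⟩
  have hsurj : Function.Surjective φ := fun a ↦ ⟨1 ⊗ₜ a, by simp [φ]⟩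
  refine Ideal.comap_injective_of_surjective (φ : R' ⊗[R] A →+* A) hsurj ?_
  refine (H (Q.comap φ) inferInstance ⟨?_⟩ heQ).trans hφP'.symm
  ext r
  rw [← hσ, Ideal.mem_comap, hQ.over, Ideal.under_def, Ideal.under_def, Ideal.mem_comap,
    Ideal.mem_comap, Ideal.mem_comap]
  simp [φ, Algebra.ofId_apply]

theorem liesOver_maximalIdeal_of_isMaximal {R : Type u} {A : Type v} [CommRing R] [IsLocalRing R]
    [CommRing A] [Algebra R A] [Algebra.IsIntegral R A] (q : Ideal A) [q.IsMaximal] :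
    q.LiesOver (maximalIdeal R) :=
  ⟨(eq_maximalIdeal (Ideal.isMaximal_comap_of_isIntegral_of_isMaximal (R := R) q)).symm⟩

/-- Finite algebras with connected spectrum over henselian local rings are local. -/
theorem isLocalRing_of_finite_of_connectedSpace {R : Type u} {A : Type v} [CommRing R]
    [HenselianLocalRing R] [CommRing A] [Algebra R A] [Module.Finite R A]
    [ConnectedSpace (PrimeSpectrum A)] : IsLocalRing A := by
  have : Nontrivial A := PrimeSpectrum.nonempty_iff_nontrivial.mp inferInstance
  obtain ⟨q, hq⟩ := Ideal.exists_maximal A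
  have := liesOver_maximalIdeal_of_isMaximal (R := R) q
  obtain ⟨e, he, heq, H⟩ := exists_isIdempotentElem_of_finite (R := R) q
  have hclopen := PrimeSpectrum.isClopen_iff.mpr ⟨e, he, rfl⟩
  have huniv := (isClopen_iff.mp hclopen).resolve_left
    (Set.nonempty_iff_ne_empty.mp ⟨⟨q, hq.isPrime⟩, heq⟩)
  refine IsLocalRing.of_unique_max_ideal ⟨q, hq, fun Q hQ ↦ ?_⟩
  have := liesOver_maximalIdeal_of_isMaximal (R := R) Q
  exact H Q hQ.isPrime this (Set.eq_univ_iff_forall.mp huniv ⟨Q, hQ.isPrime⟩)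


theorem connectedSpace_primeSpectrum_of_isLocalRing (A : Type v) [CommRing A] [IsLocalRing A] :
    ConnectedSpace (PrimeSpectrum A) := by
  have : PreconnectedSpace (PrimeSpectrum A) := by
    refine preconnectedSpace_iff_clopen.mpr fun s hs ↦ ?_
    obtain ⟨e, he, rfl⟩ := PrimeSpectrum.isClopen_iff.mp hs
    have h0 : e * (1 - e) = 0 := by rw [mul_sub, mul_one, he.eq, sub_self]
    rcases isUnit_or_isUnit_one_sub_self e with h | h
    · right
      ext x
      simpa using fun h' ↦ x.2.ne_top (Ideal.eq_top_of_isUnit_mem _ h' h)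
    · left
      rw [(IsUnit.mul_left_eq_zero h).mp h0]
      simp
  exact ⟨inferInstance⟩

/-- A nonzero finite fppf algebra over a henselian local ring has a quotient which is a finite
fppf algebra with connected spectrum. -/
theorem exists_isConnectedFiniteFppf {R : Type u} {A : Type v} [CommRing R]
    [HenselianLocalRing R] [CommRing A] [Algebra R A] [Module.Finite R A] [Module.Flat R A]
    [Algebra.FinitePresentation R A] [Nontrivial A] :
    ∃ e : A, IsConnectedFiniteFppf R (Localization.Away e) := by
  obtain ⟨q, hq⟩ := Ideal.exists_maximal A
  have := liesOver_maximalIdeal_of_isMaximal (R := R) q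
  obtain ⟨e, he, heq, H⟩ := exists_isIdempotentElem_of_finite (R := R) q
  have hsurj := IsLocalization.Away.algebraMap_surjective_of_isIdempotentElem
    (S := Localization.Away e) e he
  have hfin : Module.Finite R (Localization.Away e) :=
    Module.Finite.of_surjective
      (IsScalarTower.toAlgHom R A (Localization.Away e)).toLinearMap hsurj
  have hflat : Module.Flat R (Localization.Away e) := Module.Flat.trans R A _
  have hfp : Algebra.FinitePresentation R (Localization.Away e) :=
    Algebra.FinitePresentation.trans R A _
  have hmem (Q : Ideal (Localization.Away e)) (hQ : Q.IsMaximal) :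
      Q.comap (algebraMap A (Localization.Away e)) = q := by
    have := Ideal.comap_isMaximal_of_surjective (algebraMap A (Localization.Away e)) hsurj (K := Q)
    have := liesOver_maximalIdeal_of_isMaximal (R := R)
      (Q.comap (algebraMap A (Localization.Away e)))
    refine H _ inferInstance this fun h ↦ hQ.ne_top ?_
    exact Ideal.eq_top_of_isUnit_mem _ h (IsLocalization.Away.algebraMap_isUnit e)
  have : Nontrivial (Localization.Away e) := by
    refine not_subsingleton_iff_nontrivial.mp
      ((IsLocalization.subsingleton_iff (M := Submonoid.powers e)).not.mpr ?_)
    rintro ⟨n, hn⟩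
    exact heq (hq.isPrime.mem_of_pow_mem n (by simp_all))
  have : IsLocalRing (Localization.Away e) := by
    obtain ⟨Q, hQ⟩ := Ideal.exists_maximal (Localization.Away e)
    refine IsLocalRing.of_unique_max_ideal ⟨Q, hQ, fun Q' hQ' ↦ ?_⟩
    exact Ideal.comap_injective_of_surjective _ hsurj ((hmem Q' hQ').trans (hmem Q hQ).symm)
  have : IsLocalHom (algebraMap R (Localization.Away e)) := by
    refine ((IsLocalRing.local_hom_TFAE (algebraMap R (Localization.Away e))).out 0 4).mpr ?_
    exact ((liesOver_maximalIdeal_of_isMaximal (maximalIdeal (Localization.Away e))).over).symm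
  exact ⟨e, hfin, ⟨Module.FaithfullyFlat.of_flat_of_isLocalHom, hfp⟩,
    connectedSpace_primeSpectrum_of_isLocalRing _⟩

end Henselian

/-! ### Local rings integral over henselian and strictly local rings. -/

section Integral

open Polynomial IsLocalRing

/-- A local ring which is integral over a henselian local ring is henselian. -/
theorem henselianLocalRing_of_isIntegral (R : Type u) (S : Type v) [CommRing R]
    [HenselianLocalRing R] [CommRing S] [IsLocalRing S] [Algebra R S] [Algebra.IsIntegral R S] :
    HenselianLocalRing S where
  is_henselian f hf a₀ ha₀ ha₀' := by
    have := hf.finite_adjoinRoot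
    have := hf.free_adjoinRoot
    have : Algebra.IsIntegral R (AdjoinRoot f) := Algebra.IsIntegral.trans S
    let ρ : AdjoinRoot f →+* ResidueField S := AdjoinRoot.lift (residue S) (residue S a₀) (by
      rw [eval₂_at_apply, residue_eq_zero_iff]
      exact ha₀)
    have hρ : Function.Surjective ρ := fun y ↦ by
      obtain ⟨s, rfl⟩ := residue_surjective y
      exact ⟨AdjoinRoot.of f s, by simp [ρ]⟩
    let x : AdjoinRoot f := AdjoinRoot.root f - AdjoinRoot.of f a₀
    have hx : ρ x = 0 := by simp [ρ, x]
    -- The subalgebra R[x] is finite over `R`, so it has an idempotent isolating the point where the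
    -- root reduces to `a₀`. Inverting it cuts out of S[X]/(f) a factor `C` in which the image `y`
    -- of `x` lies in every maximal ideal.
    let F₀ := Algebra.adjoin R {x}
    have : Module.Finite R F₀ :=
      Module.Finite.iff_fg.mpr (Algebra.IsIntegral.isIntegral (R := R) x).fg_adjoin_singleton
    have hmax (n : Ideal (AdjoinRoot f)) (hn : n.IsMaximal) :
        (n.comap (algebraMap F₀ (AdjoinRoot f))).LiesOver (maximalIdeal R) := by
      have := liesOver_maximalIdeal_of_isMaximal (R := R) n
      refine ⟨this.over.trans ?_⟩
      simp only [Ideal.under_def, Ideal.comap_comap, ← IsScalarTower.algebraMap_eq]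
    have hker := RingHom.ker_isMaximal_of_surjective ρ hρ
    have := hmax _ hker
    obtain ⟨e, he, heQ, H⟩ := exists_isIdempotentElem_of_finite (R := R)
      ((RingHom.ker ρ).comap (algebraMap F₀ (AdjoinRoot f)))
    have he' : IsIdempotentElem (algebraMap F₀ (AdjoinRoot f) e) := he.map _
    let C := Localization.Away (algebraMap F₀ (AdjoinRoot f) e)
    have hsurj := IsLocalization.Away.algebraMap_surjective_of_isIdempotentElem (S := C) _ he'
    have : Module.Finite S C := Module.Finite.of_surjective
      (IsScalarTower.toAlgHom S (AdjoinRoot f) C).toLinearMap hsurj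
    have : Module.Flat S C := Module.Flat.trans S (AdjoinRoot f) C
    have : Nontrivial C := by
      refine not_subsingleton_iff_nontrivial.mp fun h ↦ ?_
      obtain ⟨n, hn⟩ := (IsLocalization.subsingleton_iff (M := Submonoid.powers
        (algebraMap F₀ (AdjoinRoot f) e)) (S := C)).mp h
      refine heQ (Ideal.mem_comap.mpr (hker.isPrime.mem_of_pow_mem n ?_))
      simp_all
    let y : C := algebraMap _ C x
    have hy (n : Ideal C) (hn : n.IsMaximal) : y ∈ n := by
      have := Ideal.comap_isMaximal_of_surjective _ hsurj (K := n)
      have h := H ((n.comap (algebraMap _ C)).comap (algebraMap F₀ (AdjoinRoot f)))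
        inferInstance (hmax _ this) fun h ↦ hn.ne_top
          (Ideal.eq_top_of_isUnit_mem _ h (IsLocalization.Away.algebraMap_isUnit _))
      have hx₀ : (⟨x, Algebra.self_mem_adjoin_singleton R x⟩ : F₀) ∈
          (RingHom.ker ρ).comap (algebraMap F₀ (AdjoinRoot f)) := hx
      rw [← h] at hx₀
      exact hx₀
    have hroot : algebraMap S C a₀ + y = algebraMap _ C (AdjoinRoot.root f) := by
      rw [IsScalarTower.algebraMap_apply S (AdjoinRoot f) C, ← map_add]
      simp [x]
    have hevalroot : (f.map (algebraMap S C)).eval (algebraMap _ C (AdjoinRoot.root f)) = 0 := by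
      rw [IsScalarTower.algebraMap_eq S (AdjoinRoot f) C, ← Polynomial.map_map, eval_map,
        eval₂_at_apply, AdjoinRoot.algebraMap_eq, eval_map, AdjoinRoot.eval₂_root, map_zero]
    have hym : y ∈ (maximalIdeal S).map (algebraMap S C) := by
      -- Taylor expansion at `a₀` gives 0 = f(a₀) + y(f′(a₀) + ky). The bracket is a unit, because
      -- f′(a₀) is one and `y` lies in every maximal ideal.
      obtain ⟨k, hk⟩ := (f.map (algebraMap S C)).binomExpansion (algebraMap S C a₀) y
      rw [hroot, hevalroot, derivative_map, eval_map, eval₂_at_apply, eval_map,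
        eval₂_at_apply] at hk
      have hv : IsUnit (algebraMap S C (f.derivative.eval a₀) + k * y) := by
        by_contra hv
        obtain ⟨n, hn, hvn⟩ := exists_max_ideal_of_mem_nonunits hv
        refine hn.ne_top (Ideal.eq_top_of_isUnit_mem _ ?_ (ha₀'.map (algebraMap S C)))
        exact (Ideal.add_mem_iff_left _ (n.mul_mem_left k (hy n hn))).mp hvn
      have h1 : y * (algebraMap S C (f.derivative.eval a₀) + k * y) =
          - algebraMap S C (f.eval a₀) := by linear_combination -hk
      refine (Ideal.mul_unit_mem_iff_mem _ hv).mp ?_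
      rw [h1]
      exact neg_mem (Ideal.mem_map_of_mem _ ha₀)
    -- `C` is generated over `S` by the root a₀ + y, which is congruent to a₀ modulo 𝔪_S C, so
    -- Nakayama applies. Faithful flatness will make S → C injective too, and the root in `C` then
    -- comes from `S`.
    have hsurj' : Function.Surjective (algebraMap S C) := by
      have hle : (⊤ : Submodule S C) ≤ LinearMap.range (Algebra.linearMap S C) := by
        refine Submodule.le_of_le_smul_of_le_jacobson_bot (I := maximalIdeal S)
          Module.Finite.fg_top (maximalIdeal_le_jacobson ⊥) fun c _ ↦ ?_
        obtain ⟨c, rfl⟩ := hsurj c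
        obtain ⟨p, rfl⟩ := AdjoinRoot.mk_surjective c
        have hp : algebraMap _ C (AdjoinRoot.mk f p) =
            (p.map (algebraMap S C)).eval (algebraMap _ C (AdjoinRoot.root f)) := by
          rw [IsScalarTower.algebraMap_eq S (AdjoinRoot f) C, ← Polynomial.map_map, eval_map,
            eval₂_at_apply, AdjoinRoot.algebraMap_eq, eval_map, ← AdjoinRoot.aeval_eq]
          rfl
        obtain ⟨d, hd⟩ := sub_dvd_eval_sub (algebraMap _ C (AdjoinRoot.root f))
          (algebraMap S C a₀) (p.map (algebraMap S C))
        rw [sub_eq_iff_eq_add] at hd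
        rw [hp, hd, add_comm, eval_map, eval₂_at_apply]
        refine Submodule.add_mem_sup ⟨_, rfl⟩ ?_
        rw [Ideal.smul_top_eq_map, Submodule.restrictScalars_mem, ← hroot, add_sub_cancel_left]
        exact Ideal.mul_mem_right _ _ hym
      exact fun c ↦ hle (Submodule.mem_top (x := c))
    have : IsLocalRing C := IsLocalRing.of_surjective' _ hsurj'
    have : IsLocalHom (algebraMap S C) := IsLocalHom.of_surjective _ hsurj'
    have : Module.FaithfullyFlat S C := Module.FaithfullyFlat.of_flat_of_isLocalHom
    have hinj := FaithfulSMul.algebraMap_injective S C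
    obtain ⟨a, ha⟩ := hsurj' (algebraMap _ C (AdjoinRoot.root f))
    refine ⟨a, hinj ?_, ?_⟩
    · rw [← eval₂_at_apply, ← eval_map, ha, hevalroot, map_zero]
    · rw [mem_maximalIdeal, mem_nonunits_iff]
      intro hu
      have := hu.map (algebraMap S C)
      rw [map_sub, ha, ← hroot, add_sub_cancel_left] at this
      obtain ⟨n, hn⟩ := Ideal.exists_maximal C
      exact hn.ne_top (Ideal.eq_top_of_isUnit_mem _ (hy n hn) this)

theorem isLocalHom_algebraMap_of_isIntegral (R : Type u) (S : Type v) [CommRing R]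
    [IsLocalRing R] [CommRing S] [IsLocalRing S] [Algebra R S] [Algebra.IsIntegral R S] :
    IsLocalHom (algebraMap R S) :=
  ((IsLocalRing.local_hom_TFAE (algebraMap R S)).out 0 4).mpr
    (liesOver_maximalIdeal_of_isMaximal (R := R) (maximalIdeal S)).over.symm

/-- A local ring which is integral over a strictly local ring is strictly local. -/
theorem isStrictlyLocal_of_isIntegral (R : Type u) (S : Type v) [CommRing R]
    [IsStrictlyLocal R] [CommRing S] [IsLocalRing S] [Algebra R S] [Algebra.IsIntegral R S] :
    IsStrictlyLocal S := by
  have := henselianLocalRing_of_isIntegral R S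
  have := isLocalHom_algebraMap_of_isIntegral R S
  have : IsSepClosed (ResidueField R) := IsStrictlyLocal.isSepClosed
  have : Algebra.IsIntegral (ResidueField R) (ResidueField S) := by
    have : Algebra.IsIntegral R (ResidueField S) :=
      Algebra.IsIntegral.trans S
    exact Algebra.IsIntegral.tower_top R
  have : Algebra.IsAlgebraic (ResidueField R) (ResidueField S) := Algebra.IsIntegral.isAlgebraic
  exact ⟨Algebra.IsAlgebraic.isSepClosed (F := ResidueField R)⟩

end Integral

/-! ### Flatness of direct limits, and the ring R₊. -/

/-- Flatness of a module which is a directed union of images of flat modules, with the zero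
relations holding at finite levels. -/
theorem flat_of_directed {ι : Type w} [Preorder ι] [IsDirectedOrder ι] [Nonempty ι]
    {R : Type u} [CommRing R] (M : ι → Type v) [∀ i, AddCommGroup (M i)] [∀ i, Module R (M i)]
    [∀ i, Module.Flat R (M i)] {S : Type w'} [AddCommGroup S] [Module R S]
    (g : ∀ i, M i →ₗ[R] S) (t : ∀ i j, i ≤ j → M i →ₗ[R] M j)
    (hg : ∀ i j h x, g j (t i j h x) = g i x) (hsurj : ∀ s, ∃ i x, g i x = s)
    (hinj : ∀ i x, g i x = 0 → ∃ j h, t i j h x = 0) : Module.Flat R S := by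
  -- Equational criterion: a linear relation has finitely many terms, so it already holds at one
  -- index, where flatness trivializes it.
  refine Module.Flat.of_forall_isTrivialRelation fun {l f x} h ↦ ?_
  choose i y hy using fun a ↦ hsurj (x a)
  obtain ⟨j, hj⟩ := Finite.exists_le i
  let z (a : Fin l) : M j := t _ _ (hj a) (y a)
  have hz (a : Fin l) : g j (z a) = x a := (hg _ _ _ _).trans (hy a)
  obtain ⟨j', hj', h0⟩ := hinj j (∑ a, f a • z a) (by simp [hz, h])
  simp only [map_sum, map_smul] at h0
  obtain ⟨k, c, w, h1, h2⟩ := Module.Flat.isTrivialRelation_of_sum_smul_eq_zero h0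
  refine ⟨k, c, fun b ↦ g j' (w b), fun a ↦ ?_, h2⟩
  have := congrArg (g j') (h1 a)
  rw [hg, hz] at this
  rw [this]
  simp

theorem map_prod_mem_of_forall_mem {A : Type u} {B : Type v} [CommMonoid A] [CommMonoid B]
    {f : A → B} (h1 : f 1 = 1) (hmul : ∀ x y, f (x * y) = f x * f y) (N : Submonoid B)
    {ι : Type w} (s : Finset ι) (a : ι → A) (h : ∀ i ∈ s, f (a i) ∈ N) : f (∏ i ∈ s, a i) ∈ N := by
  let g : A →* B := ⟨⟨f, h1⟩, hmul⟩
  change g _ ∈ N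
  rw [map_prod]
  exact prod_mem h

section Plus

open IsLocalRing

variable (R : Type u) [CommRing R]

variable {R} in
theorem Plus.exists_of (x : Plus R) : ∃ φ a, Plus.of R φ a = x := by
  induction x using DirectLimit.induction with
  | _ φ a => exact ⟨φ, a, rfl⟩

variable {R} in
theorem Plus.of_tensMap {φ ψ : Finset (Idx R)} (h : φ ≤ ψ) (a : Tens R φ) :
    Plus.of R ψ (tensMap R h a) = Plus.of R φ a :=
  (DirectLimit.eq_of_le (f := fun _ _ h ↦ tensMap R h) ⟨φ, a⟩ ψ h).symm

variable {R} in
theorem Plus.exists_tensMap_eq_zero {φ : Finset (Idx R)} (a : Tens R φ)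
    (ha : Plus.of R φ a = 0) : ∃ (ψ : Finset (Idx R)) (h : φ ≤ ψ), tensMap R h a = 0 := by
  have ha' : Plus.of R φ a = Plus.of R φ 0 := ha.trans (map_zero _).symm
  obtain ⟨ψ, h, h', h0⟩ := Quotient.exact ha'
  exact ⟨ψ, h, h0.trans (map_zero (tensMap R h'))⟩

open scoped Classical in
variable {R} in
/-- The canonical map from a representative of an isomorphism class of `ℱ(R)` to `R₊`. -/
noncomputable def Idx.toPlus (i : Idx R) : i.Alg →ₐ[R] Plus R :=
  (Plus.of R {i}).comp (PiTensorProduct.singleAlgHom (R := R)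
    (A := fun j : ({i} : Finset (Idx R)) ↦ j.1.Alg) ⟨i, Finset.mem_singleton_self i⟩)

open scoped Classical in
variable {R} in
theorem Plus.of_single (φ : Finset (Idx R)) (i : φ) (a : i.1.Alg) :
    Plus.of R φ (PiTensorProduct.singleAlgHom (R := R) (A := fun j : φ ↦ j.1.Alg) i a) =
      i.1.toPlus a := by
  have h : ({i.1} : Finset (Idx R)) ≤ φ := Finset.singleton_subset_iff.mpr i.2
  have := tensMap_single R h ⟨i.1, Finset.mem_singleton_self i.1⟩ a
  rw [Idx.toPlus, AlgHom.comp_apply, ← Plus.of_tensMap h, this]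

variable {R} in
-- A pure tensor is the product of its entries placed in single factors, so the chosen algebras
-- generate R₊. Properties of elements that cut out a subalgebra need only be checked on them.
theorem Plus.eq_top_of_range_le (N : Subalgebra R (Plus R))
    (hN : ∀ (i : Idx R) (a : i.Alg), i.toPlus a ∈ N) : N = ⊤ := by
  classical
  refine eq_top_iff.mpr fun x _ ↦ ?_
  obtain ⟨φ, a, rfl⟩ := Plus.exists_of x
  induction a using PiTensorProduct.induction_on with
  | add a b ha hb =>
    rw [map_add]
    exact add_mem (ha trivial) (hb trivial)
  | smul_tprod r a =>
    have h : PiTensorProduct.tprod R a = ∏ i : φ,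
        PiTensorProduct.singleAlgHom (R := R) (A := fun j : φ ↦ j.1.Alg) i (a i) := by
      simp only [PiTensorProduct.singleAlgHom_apply, ← PiTensorProduct.tprod_prod]
      congr 1
      ext i
      rw [Finset.prod_apply, Finset.prod_eq_single i]
      · simp
      · intro j _ hj
        rw [MonoidHom.mulSingle_apply, Pi.mulSingle_eq_of_ne hj.symm]
      · simp
    rw [map_smul, h]
    refine N.smul_mem (map_prod_mem_of_forall_mem (Plus.of R φ).map_one' (Plus.of R φ).map_mul'
      N.toSubmonoid _ _ fun i _ ↦ ?_) r
    exact (Plus.of_single φ i (a i)).symm ▸ hN _ _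

instance Idx.isFinite (i : Idx R) : Module.Finite R i.Alg := i.isConnectedFiniteFppf.finite

instance Idx.flat (i : Idx R) : Module.Flat R i.Alg := i.isConnectedFiniteFppf.isFppf.1.toFlat

instance Idx.connectedSpace (i : Idx R) : ConnectedSpace (PrimeSpectrum i.Alg) :=
  i.isConnectedFiniteFppf.connectedSpace

instance Plus.isIntegral : Algebra.IsIntegral R (Plus R) := by
  refine ⟨fun x ↦ ?_⟩
  have := Plus.eq_top_of_range_le (integralClosure R (Plus R)) fun i a ↦
    (Algebra.IsIntegral.isIntegral (R := R) a).map i.toPlus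
  exact (this ▸ Algebra.mem_top : x ∈ integralClosure R (Plus R))

section Local

variable [IsLocalRing R]

instance Tens.free (φ : Finset (Idx R)) : Module.Free R (Tens R φ) := by
  have (i : φ) : Module.Free R i.1.Alg := Module.free_of_flat_of_isLocalRing
  exact Module.Free.of_basis (Basis.piTensorProduct fun i : φ ↦ Module.Free.chooseBasis R i.1.Alg)

instance Tens.nontrivial (φ : Finset (Idx R)) : Nontrivial (Tens R φ) := by
  have (i : φ) : Module.Free R i.1.Alg := Module.free_of_flat_of_isLocalRing
  have (i : φ) : Nontrivial i.1.Alg := PrimeSpectrum.nonempty_iff_nontrivial.mp inferInstance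
  let b := Basis.piTensorProduct fun i : φ ↦ Module.Free.chooseBasis R i.1.Alg
  exact ⟨_, _, b.ne_zero fun i ↦ Classical.arbitrary _⟩

instance Plus.flat : Module.Flat R (Plus R) :=
  flat_of_directed (fun φ ↦ Tens R φ) (fun φ ↦ (Plus.of R φ).toLinearMap)
    (fun _ _ h ↦ (tensMap R h).toLinearMap) (fun _ _ h x ↦ Plus.of_tensMap h x)
    Plus.exists_of (fun _ x hx ↦ Plus.exists_tensMap_eq_zero x hx)

instance Plus.nontrivial : Nontrivial (Plus R) := by
  refine ⟨1, 0, fun h ↦ ?_⟩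
  obtain ⟨ψ, h, h0⟩ := Plus.exists_tensMap_eq_zero (1 : Tens R ∅)
    ((Plus.of R ∅).map_one'.trans h)
  exact one_ne_zero ((tensMap R h).map_one'.symm.trans h0)

end Local

theorem isPurelyInseparable_residueField (A : Type v) [CommRing A]
    [IsStrictlyLocal R] [IsLocalRing A] [Algebra R A] [Algebra.IsIntegral R A]
    [IsLocalHom (algebraMap R A)] : IsPurelyInseparable (ResidueField R) (ResidueField A) := by
  have : IsSepClosed (ResidueField R) := IsStrictlyLocal.isSepClosed
  have : Algebra.IsIntegral R (ResidueField A) := Algebra.IsIntegral.trans A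
  have : Algebra.IsIntegral (ResidueField R) (ResidueField A) := Algebra.IsIntegral.tower_top R
  have : Algebra.IsAlgebraic (ResidueField R) (ResidueField A) := Algebra.IsIntegral.isAlgebraic
  exact Algebra.IsAlgebraic.isPurelyInseparable_of_isSepClosed

/-- Let q be the exponential characteristic of k. Modulo the Jacobson radical `J`, every element of
R₊ has a q-power iterate in k, since this holds on the generators. An element of one maximal ideal
therefore has such a power in `J`, and so lies in all of them. -/
instance Plus.isLocalRing [IsStrictlyLocal R] : IsLocalRing (Plus R) := by
  obtain ⟨q, hq⟩ := ExpChar.exists (ResidueField R)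
  let J : Ideal (Plus R) := (⊥ : Ideal (Plus R)).jacobson
  have hJ {s : Plus R} : s ∈ J ↔ ∀ M : Ideal (Plus R), M.IsMaximal → s ∈ M := by
    simp [J, Ideal.jacobson]
  have hJtop : J ≠ ⊤ := by
    obtain ⟨M, hM⟩ := Ideal.exists_maximal (Plus R)
    exact fun h ↦ hM.ne_top ((Ideal.eq_top_iff_one _).mpr (hJ.mp (h ▸ Submodule.mem_top) M hM))
  have : Nontrivial (Plus R ⧸ J) := Ideal.Quotient.nontrivial_iff.mpr hJtop
  -- Well defined because, by integrality, every maximal ideal of R₊ lies over that of `R`.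
  let c : ResidueField R →+* Plus R ⧸ J :=
    Ideal.Quotient.lift _ (algebraMap R (Plus R ⧸ J)) fun r hr ↦ by
      refine Ideal.Quotient.eq_zero_iff_mem.mpr (hJ.mpr fun M hM ↦ ?_)
      rwa [(liesOver_maximalIdeal_of_isMaximal (R := R) M).over] at hr
  have hc (r : R) : c (residue R r) = Ideal.Quotient.mk J (algebraMap R (Plus R) r) := rfl
  have : ExpChar (Plus R ⧸ J) q := expChar_of_injective_ringHom c.injective q
  -- Closed under addition because q-th powers are additive in R₊/J.
  let N : Subalgebra R (Plus R) :=
    { carrier := {s | ∃ n a, (Ideal.Quotient.mk J s) ^ q ^ n = c a}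
      mul_mem' := by
        rintro s t ⟨n, a, hn⟩ ⟨m, b, hm⟩
        refine ⟨n + m, a ^ q ^ m * b ^ q ^ n, ?_⟩
        rw [map_mul, mul_pow, map_mul, map_pow, map_pow, ← hn, ← hm, ← pow_mul, ← pow_mul,
          pow_add, mul_comm (q ^ m)]
      add_mem' := by
        rintro s t ⟨n, a, hn⟩ ⟨m, b, hm⟩
        refine ⟨n + m, a ^ q ^ m + b ^ q ^ n, ?_⟩
        rw [map_add, add_pow_expChar_pow, map_add, map_pow, map_pow, ← hn, ← hm, ← pow_mul,
          ← pow_mul, pow_add, mul_comm (q ^ m)]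
      algebraMap_mem' r := ⟨0, residue R r, by rw [pow_zero, pow_one, hc]⟩ }
  have hN : N = ⊤ := by
    refine Plus.eq_top_of_range_le N fun i a ↦ ?_
    have : IsLocalRing i.Alg := isLocalRing_of_finite_of_connectedSpace (R := R)
    have := isLocalHom_algebraMap_of_isIntegral R i.Alg
    have := isPurelyInseparable_residueField R i.Alg
    obtain ⟨n, b, hb⟩ := IsPurelyInseparable.pow_mem (ResidueField R) q (residue i.Alg a)
    obtain ⟨r, rfl⟩ := residue_surjective b
    refine ⟨n, residue R r, ?_⟩
    rw [hc, ← map_pow, Ideal.Quotient.eq, hJ]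
    intro M hM
    have hr : a ^ q ^ n - algebraMap R i.Alg r ∈ maximalIdeal i.Alg := by
      rw [← residue_eq_zero_iff, map_sub, map_pow, ← hb, sub_eq_zero]
      rfl
    -- Two integral extensions are used: M contracts to a maximal ideal of `R`, so its contraction
    -- to the local ring `i.Alg` is the maximal ideal.
    have : ((M.comap i.toPlus).comap (algebraMap R i.Alg)).IsMaximal := by
      have h1 : (M.comap i.toPlus).comap (algebraMap R i.Alg) = M.comap (algebraMap R (Plus R)) := by
        ext r
        simp
      rw [h1]
      exact Ideal.isMaximal_comap_of_isIntegral_of_isMaximal M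
    have := Ideal.isMaximal_of_isIntegral_of_isMaximal_comap (R := R) (M.comap i.toPlus) this
    rw [← eq_maximalIdeal this, Ideal.mem_comap] at hr
    simpa using hr
  obtain ⟨M, hM⟩ := Ideal.exists_maximal (Plus R)
  have key (M M' : Ideal (Plus R)) (hM : M.IsMaximal) (hM' : M'.IsMaximal) : M ≤ M' := by
    intro s hs
    obtain ⟨n, a, hn⟩ : s ∈ N := hN ▸ Algebra.mem_top
    have ha : a = 0 := by
      by_contra ha
      have hu := (isUnit_iff_ne_zero.mpr ha).map c
      rw [← hn] at hu
      let l : Plus R ⧸ J →+* Plus R ⧸ M := Ideal.Quotient.factor fun s hs ↦ hJ.mp hs M hM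
      have hu' := hu.map l
      have : l (Ideal.Quotient.mk J s) = 0 := Ideal.Quotient.eq_zero_iff_mem.mpr hs
      have := Ideal.Quotient.nontrivial_iff.mpr hM.ne_top
      have hq0 : q ^ n ≠ 0 := (pow_pos (expChar_pos (ResidueField R) q) n).ne'
      rw [map_pow, ‹l _ = 0›, zero_pow hq0] at hu'
      exact not_isUnit_zero hu'
    rw [ha, map_zero, ← map_pow, Ideal.Quotient.eq_zero_iff_mem] at hn
    exact hM'.isPrime.mem_of_pow_mem _ (hJ.mp hn M' hM')
  exact IsLocalRing.of_unique_max_ideal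
    ⟨M, hM, fun M' hM' ↦ le_antisymm (key _ _ hM' hM) (key _ _ hM hM')⟩

end Plus

/-! ### The fibre criterion and quasi-finite algebras. -/

section Fibre

open IsLocalRing

/-- The fibre criterion of flatness for finitely presented modules over a local ring: flatness over
a base and freeness of the closed fibre imply freeness. -/
theorem free_of_flat_of_flat_fibre {R : Type u} {A : Type v} {M : Type w} [CommRing R]
    [IsLocalRing R] [CommRing A] [IsLocalRing A] [Algebra R A] [IsLocalHom (algebraMap R A)]
    [AddCommGroup M] [Module R M] [Module A M] [IsScalarTower R A M]
    [Module.FinitePresentation A M] [Module.Flat R M]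
    [Module.Flat (A ⧸ (maximalIdeal R).map (algebraMap R A))
      ((A ⧸ (maximalIdeal R).map (algebraMap R A)) ⊗[A] M)] : Module.Free A M := by
  let I := (maximalIdeal R).map (algebraMap R A)
  have hI : I ≤ maximalIdeal A := map_maximalIdeal_le (algebraMap R A)
  have : Nontrivial (A ⧸ I) := Ideal.Quotient.nontrivial_iff.mpr
    (ne_top_of_le_ne_top (Ideal.IsPrime.ne_top inferInstance) hI)
  have : IsLocalRing (A ⧸ I) := IsLocalRing.of_surjective' _ Ideal.Quotient.mk_surjective
  have : Module.Free (A ⧸ I) ((A ⧸ I) ⊗[A] M) := Module.free_of_flat_of_isLocalRing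
  let b := Module.Free.chooseBasis (A ⧸ I) ((A ⧸ I) ⊗[A] M)
  let ι := Module.Free.ChooseBasisIndex (A ⧸ I) ((A ⧸ I) ⊗[A] M)
  have hsurj : Function.Surjective (TensorProduct.mk A (A ⧸ I) M 1) :=
    TensorProduct.mk_surjective _ _ _ Ideal.Quotient.mk_surjective
  choose c hc using fun i ↦ hsurj (b i)
  -- A lift of a basis of the closed fibre. It is onto by Nakayama, so its kernel is finitely
  -- generated; the kernel vanishes once it is contained in `I` times itself.
  let φ : (ι → A) →ₗ[A] M := Fintype.linearCombination A c
  have hφ (x : ι → A) : (1 : A ⧸ I) ⊗ₜ[A] φ x = ∑ i, Ideal.Quotient.mk I (x i) • b i := by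
    simp only [φ, Fintype.linearCombination_apply, TensorProduct.tmul_sum, TensorProduct.tmul_smul]
    refine Finset.sum_congr rfl fun i _ ↦ ?_
    rw [← hc i]
    rfl
  have hker (m : M) (hm : (1 : A ⧸ I) ⊗ₜ[A] m = 0) : m ∈ I • (⊤ : Submodule A M) := by
    have := congrArg (TensorProduct.quotTensorEquivQuotSMul M I) hm
    rw [map_zero] at this
    simpa using this
  have hrange : Function.Surjective φ := by
    have hle : (⊤ : Submodule A M) ≤ LinearMap.range φ := by
      refine Submodule.le_of_le_smul_of_le_jacobson_bot (I := I) Module.Finite.fg_top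
        (hI.trans (maximalIdeal_le_jacobson ⊥)) fun m _ ↦ ?_
      choose x hx using fun i ↦ Ideal.Quotient.mk_surjective (I := I) (b.repr (1 ⊗ₜ m) i)
      have hm : (1 : A ⧸ I) ⊗ₜ[A] (m - φ x) = 0 := by
        rw [TensorProduct.tmul_sub, hφ, sub_eq_zero]
        simp only [hx]
        exact (b.sum_repr _).symm
      have := Submodule.add_mem_sup (LinearMap.mem_range_self φ x) (hker _ hm)
      rwa [add_sub_cancel] at this
    exact fun m ↦ hle (Submodule.mem_top (x := m))
  have hfg : (LinearMap.ker φ).FG := Module.FinitePresentation.fg_ker φ hrange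
  have hbot : LinearMap.ker φ = ⊥ := by
    refine Submodule.eq_bot_of_le_smul_of_le_jacobson_bot I _ hfg (fun x hx ↦ ?_)
      (hI.trans (maximalIdeal_le_jacobson ⊥))
    have hxI (i : ι) : x i ∈ I := by
      have h0 := hφ x
      rw [LinearMap.mem_ker.mp hx, TensorProduct.tmul_zero] at h0
      exact Ideal.Quotient.eq_zero_iff_mem.mp
        (Fintype.linearIndependent_iff.mp b.linearIndependent _ h0.symm i)
    have hxmem : x ∈ maximalIdeal R • (⊤ : Submodule R (ι → A)) := by
      classical
      have hxA : x ∈ I • (⊤ : Submodule A (ι → A)) := by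
        rw [pi_eq_sum_univ' x]
        exact sum_mem fun i _ ↦ Submodule.smul_mem_smul (hxI i) trivial
      rwa [← Submodule.restrictScalars_mem R, Ideal.smul_restrictScalars] at hxA
    have hspan : Submodule.span R (Set.range (id : (ι → A) → ι → A)) = ⊤ := by simp
    rw [← hspan, Submodule.mem_ideal_smul_span_iff_exists_sum] at hxmem
    obtain ⟨a₀, ha₀, hsum₀⟩ := hxmem
    obtain ⟨κ, _, r, y, hr, rfl⟩ : ∃ (κ : Type (max v w)) (_ : Fintype κ) (r : κ → R)
        (y : κ → ι → A), (∀ j, r j ∈ maximalIdeal R) ∧ ∑ j, r j • y j = x :=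
      ⟨a₀.support, inferInstance, fun j ↦ a₀ j, fun j ↦ j, fun j ↦ ha₀ _, by
        rw [← hsum₀, Finsupp.sum, Finset.sum_coe_sort a₀.support fun j ↦ a₀ j • j]
        rfl⟩
    have h0 : ∑ j, r j • φ (y j) = 0 := by
      rw [← LinearMap.mem_ker.mp hx, map_sum]
      refine Finset.sum_congr rfl fun j _ ↦ ?_
      rw [← algebraMap_smul A (r j) (y j), map_smul, algebraMap_smul]
    -- Flatness over `R` trivializes the relation Σ rⱼ φ(yⱼ) = 0. Subtracting from the yⱼ lifts of
    -- the trivialization moves them into the kernel and leaves Σ rⱼ yⱼ unchanged.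
    obtain ⟨k, a, z, hyz, hra⟩ := Module.Flat.isTrivialRelation_of_sum_smul_eq_zero h0
    choose w hw using fun l ↦ hrange (z l)
    have hmem (j : κ) : y j - ∑ l, algebraMap R A (a j l) • w l ∈ LinearMap.ker φ := by
      rw [LinearMap.mem_ker, map_sub, map_sum, sub_eq_zero]
      refine (hyz j).trans ?_
      refine Finset.sum_congr rfl fun l _ ↦ ?_
      rw [map_smul, hw, algebraMap_smul]
    have hsum : ∑ j, r j • y j =
        ∑ j, algebraMap R A (r j) • (y j - ∑ l, algebraMap R A (a j l) • w l) := by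
      simp only [smul_sub, Finset.sum_sub_distrib, Finset.smul_sum, smul_smul, ← map_mul]
      rw [Finset.sum_comm (s := Finset.univ (α := κ))]
      simp only [← Finset.sum_smul, hra, zero_smul, Finset.sum_const_zero,
        sub_zero, algebraMap_smul]
    rw [hsum]
    exact sum_mem fun j _ ↦ Submodule.smul_mem_smul (Ideal.mem_map_of_mem _ (hr j)) (hmem j)
  exact Module.Free.of_equiv (LinearEquiv.ofBijective φ ⟨LinearMap.ker_eq_bot.mp hbot, hrange⟩)

theorem flat_tensorProduct_of_flat_of_flat {R : Type u} {P : Type v} {A : Type w} {B : Type w'}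
    [CommRing R] [CommRing P] [CommRing A] [CommRing B] [Algebra R P] [Algebra R A] [Algebra R B]
    [Algebra P A] [Algebra P B] [IsScalarTower R P A] [IsScalarTower R P B]
    [Module.Flat P A] [Module.Flat R B] : Module.Flat R (A ⊗[P] B) := by
  have : Module.Flat R (B ⊗[P] A) := Module.Flat.trans R B _
  exact Module.Flat.of_linearEquiv ((TensorProduct.comm P A B).restrictScalars R)

/-- Inverting an idempotent gives a direct summand, with section induced by multiplication by `e`;
retracts of flat modules are flat. -/
theorem flat_tensorProduct_away_of_isIdempotentElem {P : Type u} {X : Type v} {K : Type w}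
    [CommRing P] [CommRing X] [Algebra P X] [CommRing K] [Algebra P K] {e : X}
    (he : IsIdempotentElem e) [Module.Flat K (K ⊗[P] X)] :
    Module.Flat K (K ⊗[P] Localization.Away e) := by
  have hsurj := IsLocalization.Away.algebraMap_surjective_of_isIdempotentElem
    (S := Localization.Away e) e he
  let r : X →ₗ[X] Localization.Away e := Algebra.linearMap X _
  have hle : LinearMap.ker r ≤ LinearMap.ker (LinearMap.mulLeft X e) := by
    intro x hx
    obtain ⟨⟨_, n, rfl⟩, hn⟩ :=
      (IsLocalization.map_eq_zero_iff (Submonoid.powers e) (Localization.Away e) x).mp hx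
    rw [LinearMap.mem_ker, LinearMap.mulLeft_apply]
    have h1 : e ^ (n + 1) * x = 0 := by rw [pow_succ', mul_assoc, hn, mul_zero]
    rwa [he.pow_succ_eq] at h1
  let i : Localization.Away e →ₗ[X] X := (Submodule.liftQ _ (LinearMap.mulLeft X e) hle).comp
    (r.quotKerEquivOfSurjective hsurj).symm.toLinearMap
  have hi (x : X) : i (r x) = e * x := by
    have : (r.quotKerEquivOfSurjective hsurj).symm (r x) = Submodule.Quotient.mk x := by
      rw [LinearEquiv.symm_apply_eq]
      rfl
    exact (congrArg (Submodule.liftQ _ (LinearMap.mulLeft X e) hle) this).trans rfl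
  have hri : r.comp i = LinearMap.id := by
    ext y
    obtain ⟨x, rfl⟩ := hsurj y
    change r (i (r x)) = r x
    have he1 : r e = 1 := (IsIdempotentElem.iff_eq_one_of_isUnit
      (IsLocalization.Away.algebraMap_isUnit e)).mp (he.map (algebraMap X (Localization.Away e)))
    rw [hi]
    change algebraMap _ _ (e * x) = _
    rw [map_mul]
    change r e * r x = r x
    rw [he1, one_mul]
  refine Module.Flat.of_retract ((i.restrictScalars P).baseChange K)
    ((r.restrictScalars P).baseChange K) ?_
  rw [← LinearMap.baseChange_comp]
  have : (r.restrictScalars P).comp (i.restrictScalars P) = LinearMap.id := by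
    ext y
    exact DFunLike.congr_fun hri y
  rw [this, LinearMap.baseChange_id]

/-- Let `B` be an algebra of finite presentation over `P`, quasi-finite at a prime `q`, and flat
over a local ring `R`. If the closed fibre of `B` over `R` is flat over the closed fibre of `P` near
the image `p` of `q`, then `B` has a point in a finite free algebra over any `P`-algebra which is a
henselian local ring centered at `p`. -/
theorem exists_finite_free_of_quasiFiniteAt {R P B S : Type u} [CommRing R] [IsLocalRing R]
    [CommRing P] [Algebra R P] [CommRing B] [Algebra R B] [Algebra P B] [IsScalarTower R P B]
    [Algebra.FinitePresentation P B] [Module.Flat R B] [CommRing S] [HenselianLocalRing S]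
    [Algebra P S] (p : Ideal P) [p.IsPrime] (hp : (maximalIdeal S).comap (algebraMap P S) = p)
    (hpR : p.comap (algebraMap R P) = maximalIdeal R)
    (q : Ideal B) [q.IsPrime] [q.LiesOver p] [Algebra.QuasiFiniteAt P q]
    (hflat : ∀ (K : Type u) [CommRing K] [Algebra P K],
      (∀ r ∈ maximalIdeal R, algebraMap P K (algebraMap R P r) = 0) →
      (∀ x ∉ p, IsUnit (algebraMap P K x)) → Module.Flat K (K ⊗[P] B)) :
    ∃ (C : Type u) (_ : CommRing C) (_ : Algebra S C), Module.Finite S C ∧ Module.Free S C ∧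
      Algebra.FinitePresentation S C ∧ Nontrivial C ∧
      ∃ f : B →+* C, ∀ x, f (algebraMap P B x) = algebraMap S C (algebraMap P S x) := by
  obtain ⟨P', _, _, _, p', _, _, e, he, Q', _, _, hQ'q, heQ', hb, hfin, -⟩ :=
    Algebra.exists_etale_isIdempotentElem_forall_liesOver_eq p q
  obtain ⟨σ, hσ⟩ := exists_lift_of_etale_of_bijective (S := S) p hp p' hb
  let _ : Algebra R P' := ((algebraMap P P').comp (algebraMap R P)).toAlgebra
  have : IsScalarTower R P P' := .of_algebraMap_eq fun _ ↦ rfl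
  let A := Localization.AtPrime p'
  let X := P' ⊗[P] B
  let B' := Localization.Away e
  have : Algebra.FinitePresentation P' B' := Algebra.FinitePresentation.trans P' X B'
  have : Module.FinitePresentation P' B' :=
    Module.FinitePresentation.of_finite_of_finitePresentation P' B'
  have : Module.Flat R X := flat_tensorProduct_of_flat_of_flat
  have : Module.Flat R B' := Module.Flat.trans R X B'
  let M := A ⊗[P'] B'
  have : Module.Flat R M := flat_tensorProduct_of_flat_of_flat
  have : IsLocalHom (algebraMap R A) := by
    refine ((IsLocalRing.local_hom_TFAE (algebraMap R A)).out 0 4).mpr ?_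
    have h := IsLocalization.AtPrime.under_maximalIdeal A p'
    rw [Ideal.under_def] at h
    have h' : p'.comap (algebraMap P P') = p := (p'.over_def p).symm
    rw [IsScalarTower.algebraMap_eq R P' A, ← Ideal.comap_comap, h,
      IsScalarTower.algebraMap_eq R P P', ← Ideal.comap_comap, h', hpR]
  let K := A ⧸ (maximalIdeal R).map (algebraMap R A)
  -- This `K` depends on the étale neighbourhood, which is chosen inside the proof; hence `hflat` is
  -- assumed for all `K`.
  have : Module.Flat K (K ⊗[P] B) := by
    refine hflat K (fun r hr ↦ ?_) fun x hx ↦ ?_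
    · rw [← IsScalarTower.algebraMap_apply R P K, IsScalarTower.algebraMap_apply R A K]
      exact Ideal.Quotient.eq_zero_iff_mem.mpr (Ideal.mem_map_of_mem _ hr)
    · rw [IsScalarTower.algebraMap_apply P A K, IsScalarTower.algebraMap_apply P P' A]
      refine IsUnit.map _ (IsLocalization.map_units A (⟨_, fun h ↦ hx ?_⟩ : p'.primeCompl))
      rwa [p'.over_def p]
  have : Module.Flat K (K ⊗[P'] X) := Module.Flat.of_linearEquiv
    (TensorProduct.AlgebraTensorModule.cancelBaseChange P P' K K B)
  have : Module.Flat K (K ⊗[P'] B') := flat_tensorProduct_away_of_isIdempotentElem he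
  have : Module.Flat K (K ⊗[A] M) := Module.Flat.of_linearEquiv
    (TensorProduct.AlgebraTensorModule.cancelBaseChange P' A K K B')
  have : Module.Free A M := free_of_flat_of_flat_fibre (R := R)
  -- `Q'` lies over `p'` and avoids `e`, so `A` and `B'` both map to its residue field, compatibly
  -- over `P'`.
  have : Nontrivial M := by
    let f : A →ₐ[P'] Q'.ResidueField := IsLocalization.liftAlgHom (M := p'.primeCompl)
      (f := Algebra.ofId P' Q'.ResidueField) fun x ↦ by
        rw [Algebra.ofId_apply, IsScalarTower.algebraMap_apply P' X, isUnit_iff_ne_zero, ne_eq,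
          Ideal.algebraMap_residueField_eq_zero]
        intro h
        have hx : x.1 ∈ Q'.under P' := h
        rw [← Q'.over_def p'] at hx
        exact x.2 hx
    let g : B' →ₐ[P'] Q'.ResidueField := IsLocalization.liftAlgHom (M := Submonoid.powers e)
      (f := IsScalarTower.toAlgHom P' X Q'.ResidueField) (by
        rintro ⟨_, n, rfl⟩
        rw [map_pow]
        refine IsUnit.pow _ ?_
        rw [isUnit_iff_ne_zero, ne_eq]
        exact fun h ↦ heQ' (Ideal.algebraMap_residueField_eq_zero.mp h))
    exact (Algebra.TensorProduct.lift f g fun _ _ ↦ Commute.all _ _).toRingHom.domain_nontrivial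
  let _ : Algebra P' S := σ.toAlgebra
  let τ : A →ₐ[P'] S := IsLocalization.liftAlgHom (M := p'.primeCompl) (f := Algebra.ofId P' S)
    fun x ↦ by
      by_contra hx
      exact x.2 (hσ ▸ hx)
  let _ : Algebra A S := τ.toAlgebra
  have : IsScalarTower P' A S := .of_algebraMap_eq fun x ↦ (τ.commutes x).symm
  let E : S ⊗[A] M ≃ₗ[S] S ⊗[P'] B' :=
    TensorProduct.AlgebraTensorModule.cancelBaseChange P' A S S B'
  refine ⟨S ⊗[P'] B', inferInstance, inferInstance, inferInstance, Module.Free.of_equiv E,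
    inferInstance, E.symm.toEquiv.nontrivial, (Algebra.TensorProduct.includeRight (R := P')
      (A := S) (B := B')).toRingHom.comp ((algebraMap X B').comp
      (Algebra.TensorProduct.includeRight (R := P) (A := P') (B := B)).toRingHom), fun x ↦ ?_⟩
  have h1 : (1 : P') ⊗ₜ[P] algebraMap P B x = algebraMap P' X (algebraMap P P' x) := by
    rw [← IsScalarTower.algebraMap_apply P P' X]
    exact (Algebra.TensorProduct.includeRight (R := P) (A := P') (B := B)).commutes x
  have h2 : (1 : S) ⊗ₜ[P'] algebraMap P' B' (algebraMap P P' x) =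
      algebraMap S (S ⊗[P'] B') (algebraMap P S x) := by
    have := (Algebra.TensorProduct.includeRight (R := P') (A := S) (B := B')).commutes
      (algebraMap P P' x)
    refine this.trans ?_
    rw [IsScalarTower.algebraMap_apply P' S (S ⊗[P'] B')]
    exact congrArg _ (σ.commutes x)
  change (1 : S) ⊗ₜ[P'] algebraMap X B' ((1 : P') ⊗ₜ[P] algebraMap P B x) = _
  rw [h1, ← IsScalarTower.algebraMap_apply P' X B', h2]

end Fibre

/-! ### Points of fppf algebras in finite free algebras. -/

section Slice

open IsLocalRing

/-- Separably closed fields are infinite. -/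
theorem infinite_of_isSepClosed (k : Type u) [Field k] [IsSepClosed k] : Infinite k := by
  by_contra h
  have : Finite k := not_infinite_iff_finite.mp h
  -- Finite fields are perfect, so a separably closed one would be algebraically closed, hence
  -- infinite.
  have : IsAlgClosed k := inferInstance
  exact h inferInstance

/-- A finite module over a polynomial ring over an infinite field is free at some rational point. -/
theorem exists_mem_freeLocus_of_infinite {k : Type u} [Field k] [Infinite k] {n : ℕ} (N : Type u)
    [AddCommGroup N] [Module (MvPolynomial (Fin n) k) N]
    [Module.Finite (MvPolynomial (Fin n) k) N] :
    ∃ c : Fin n → k, ∀ p : PrimeSpectrum (MvPolynomial (Fin n) k),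
      p.asIdeal = RingHom.ker (MvPolynomial.eval c) →
        p ∈ Module.freeLocus (MvPolynomial (Fin n) k) N := by
  have := Module.finitePresentation_of_finite (MvPolynomial (Fin n) k) N
  -- At the generic point every module is free. The free locus is open, so it contains some D(r)
  -- with r ≠ 0, and r has a nonzero value at a rational point.
  let x₀ : PrimeSpectrum (MvPolynomial (Fin n) k) := ⟨⊥, Ideal.isPrime_bot⟩
  have hx₀ : x₀ ∈ Module.freeLocus (MvPolynomial (Fin n) k) N := by
    have h : IsLocalization.AtPrime (FractionRing (MvPolynomial (Fin n) k)) x₀.asIdeal := by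
      have : x₀.asIdeal.primeCompl = nonZeroDivisors (MvPolynomial (Fin n) k) :=
        Ideal.primeCompl_bot
      rw [IsLocalization.AtPrime, this]
      infer_instance
    rw [Module.mem_freeLocus_iff_tensor x₀ (FractionRing (MvPolynomial (Fin n) k))]
    exact Module.Free.of_divisionRing _ _
  obtain ⟨_, ⟨r, rfl⟩, hr, hrN⟩ :=
    PrimeSpectrum.isTopologicalBasis_basic_opens.exists_subset_of_mem_open hx₀
      (Module.isOpen_freeLocus (R := MvPolynomial (Fin n) k) (M := N))
  have hr0 : r ≠ 0 := hr
  obtain ⟨c, hc⟩ : ∃ c, MvPolynomial.eval c r ≠ 0 := by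
    by_contra! h
    exact hr0 (MvPolynomial.funext fun c ↦ by rw [h c, map_zero])
  refine ⟨c, fun p hp ↦ hrN ?_⟩
  change r ∉ p.asIdeal
  rwa [hp]

theorem flat_tensorProduct_of_mem_freeLocus {A : Type u} {N : Type v} [CommRing A]
    [AddCommGroup N] [Module A N] {p : PrimeSpectrum A} (hp : p ∈ Module.freeLocus A N)
    (K : Type w) [CommRing K] [Algebra A K] (hK : ∀ x ∉ p.asIdeal, IsUnit (algebraMap A K x)) :
    Module.Flat K (K ⊗[A] N) := by
  rw [Module.mem_freeLocus_iff_tensor p (Localization.AtPrime p.asIdeal)] at hp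
  let φ : Localization.AtPrime p.asIdeal →+* K :=
    IsLocalization.lift (M := p.asIdeal.primeCompl) (g := algebraMap A K) fun y ↦ hK y.1 y.2
  let _ : Algebra (Localization.AtPrime p.asIdeal) K := φ.toAlgebra
  have : IsScalarTower A (Localization.AtPrime p.asIdeal) K :=
    .of_algebraMap_eq fun x ↦ (IsLocalization.lift_eq _ x).symm
  exact Module.Flat.of_linearEquiv
    (TensorProduct.AlgebraTensorModule.cancelBaseChange A (Localization.AtPrime p.asIdeal)
      K K N).symm

/-- The algebra structure over a quotient `Q` of `P` on a `P`-algebra killed by the kernel. -/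
theorem exists_algebra_of_ker_le {P : Type u} {Q : Type v} {K : Type w} [CommRing P] [CommRing Q]
    [CommRing K] [Algebra P Q] [Algebra P K] (hsurj : Function.Surjective (algebraMap P Q))
    (h : RingHom.ker (algebraMap P Q) ≤ RingHom.ker (algebraMap P K)) :
    ∃ _ : Algebra Q K, IsScalarTower P Q K := by
  let φ : Q →+* K := (algebraMap P Q).liftOfSurjective hsurj ⟨algebraMap P K, h⟩
  let a : Algebra Q K := φ.toAlgebra
  refine ⟨a, .of_algebraMap_eq fun x ↦ ?_⟩
  exact (RingHom.liftOfRightInverse_comp_apply _ _ (Function.rightInverse_surjInv hsurj)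
    ⟨algebraMap P K, h⟩ x).symm

/-- Let `B` be of finite presentation over `P` and flat over a local ring `R`, with closed fibre
finite over that of `P` and free at a point `x`. Then `B` maps to a nonzero finite free algebra over
any henselian local `P`-algebra `S` with closed point over `x`. -/
theorem exists_finite_free_of_finite_fibre {R P B Q S : Type u} [CommRing R] [IsLocalRing R]
    [CommRing P] [Algebra R P] [CommRing B] [Algebra R B] [Algebra P B] [IsScalarTower R P B]
    [Algebra.FinitePresentation P B] [Module.Flat R B] [CommRing Q] [Algebra P Q]
    (hsurj : Function.Surjective (algebraMap P Q))
    (hker : RingHom.ker (algebraMap P Q) = (maximalIdeal R).map (algebraMap R P))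
    [Module.Finite Q (Q ⊗[P] B)] (hinj : Function.Injective (algebraMap Q (Q ⊗[P] B)))
    (x : PrimeSpectrum Q) (hx : x ∈ Module.freeLocus Q (Q ⊗[P] B))
    [CommRing S] [HenselianLocalRing S] [Algebra P S]
    (hS : (maximalIdeal S).comap (algebraMap P S) = x.asIdeal.comap (algebraMap P Q)) :
    ∃ (C : Type u) (_ : CommRing C) (_ : Algebra S C), Module.Finite S C ∧ Module.Free S C ∧
      Algebra.FinitePresentation S C ∧ Nontrivial C ∧
      ∃ f : B →+* C, ∀ x, f (algebraMap P B x) = algebraMap S C (algebraMap P S x) := by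
  let p : Ideal P := x.asIdeal.comap (algebraMap P Q)
  have hkerp : RingHom.ker (algebraMap P Q) ≤ p := Ideal.comap_mono bot_le
  have hpR : p.comap (algebraMap R P) = maximalIdeal R := by
    refine ((maximalIdeal.isMaximal R).eq_of_le (Ideal.IsPrime.ne_top inferInstance) ?_).symm
    rw [← Ideal.map_le_iff_le_comap, ← hker]
    exact hkerp
  have hbc (K : Type u) [CommRing K] [Algebra P K]
      (hK : ∀ r ∈ maximalIdeal R, algebraMap P K (algebraMap R P r) = 0) :
      ∃ _ : Algebra Q K, IsScalarTower P Q K := by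
    refine exists_algebra_of_ker_le hsurj ?_
    rw [hker, Ideal.map_le_iff_le_comap]
    exact hK
  -- Lying over for the finite injective map from `Q` gives the prime of `B` above `x` at which `B`
  -- is quasi-finite.
  obtain ⟨N', _, hN'⟩ := Ideal.exists_ideal_over_prime_of_isIntegral (S := Q ⊗[P] B)
    x.asIdeal ⊥ (by
    rw [← RingHom.ker_eq_comap_bot, (RingHom.injective_iff_ker_eq_bot _).mp hinj]
    exact bot_le)
  let q : Ideal B := N'.comap (Algebra.TensorProduct.includeRight : B →ₐ[P] Q ⊗[P] B).toRingHom
  have := hN'.1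
  have : q.IsPrime := Ideal.comap_isPrime _ _
  have hq : p = q.comap (algebraMap P B) := by
    change x.asIdeal.comap (algebraMap P Q) = _
    rw [← hN'.2, Ideal.comap_comap, Ideal.comap_comap, ← IsScalarTower.algebraMap_eq]
    congr 1
    exact (AlgHom.comp_algebraMap
      (Algebra.TensorProduct.includeRight : B →ₐ[P] Q ⊗[P] B)).symm
  have : q.LiesOver p := ⟨hq⟩
  have : Algebra.QuasiFiniteAt P q := by
    obtain ⟨_, _⟩ := hbc p.ResidueField fun r hr ↦ by
      rw [Ideal.algebraMap_residueField_eq_zero]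
      exact hpR.ge hr
    have : Module.Finite p.ResidueField (p.Fiber B) :=
      Module.Finite.equiv (TensorProduct.AlgebraTensorModule.cancelBaseChange P Q
        p.ResidueField p.ResidueField B)
    let e := PrimeSpectrum.preimageEquivFiber P B ⟨p, inferInstance⟩
    let y : PrimeSpectrum.comap (algebraMap P B) ⁻¹' {(⟨p, inferInstance⟩ : PrimeSpectrum P)} :=
      ⟨⟨q, inferInstance⟩, PrimeSpectrum.ext hq.symm⟩
    have : (e y).asIdeal.IsPrime := (e y).isPrime
    have : Algebra.QuasiFiniteAt p.ResidueField (e y).asIdeal :=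
      inferInstanceAs (Algebra.QuasiFinite p.ResidueField (Localization.AtPrime (e y).asIdeal))
    exact Algebra.QuasiFiniteAt.of_quasiFiniteAt_residueField p q (e y).asIdeal
      congr($(e.symm_apply_apply y).1.asIdeal)
  refine exists_finite_free_of_quasiFiniteAt (R := R) p hS hpR q fun K _ _ hK hK' ↦ ?_
  obtain ⟨_, _⟩ := hbc K hK
  have : Module.Flat K (K ⊗[Q] (Q ⊗[P] B)) := by
    refine flat_tensorProduct_of_mem_freeLocus hx K fun y hy ↦ ?_
    obtain ⟨y, rfl⟩ := hsurj y
    rw [← IsScalarTower.algebraMap_apply]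
    exact hK' y hy
  exact Module.Flat.of_linearEquiv
    (TensorProduct.AlgebraTensorModule.cancelBaseChange P Q K K B).symm

/-- Every fppf algebra over a strictly local ring maps to a nonzero finite free algebra. -/
theorem exists_algHom_finite_free {R B : Type u} [CommRing R] [IsStrictlyLocal R] [CommRing B]
    [Algebra R B] (hB : IsFppf R B) :
    ∃ (C : Type u) (_ : CommRing C) (_ : Algebra R C), Module.Finite R C ∧ Module.Free R C ∧
      Algebra.FinitePresentation R C ∧ Nontrivial C ∧ Nonempty (B →ₐ[R] C) := by
  have := hB.faithfullyFlat
  have := hB.finitePresentation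
  have := IsStrictlyLocal.isSepClosed (R := R)
  let k := ResidueField R
  have : Infinite k := infinite_of_isSepClosed k
  let B₀ := k ⊗[R] B
  have : Nontrivial B₀ := inferInstance
  -- Noether normalization of the closed fibre, nonzero by faithful flatness. The images of the
  -- variables are then lifted to `B`.
  obtain ⟨n, g, hg, hgfin⟩ := exists_finite_inj_algHom_of_fg k B₀
  have hsurjB : Function.Surjective (Algebra.TensorProduct.includeRight : B →ₐ[R] B₀) :=
    Algebra.TensorProduct.includeRight_surjective _ residue_surjective
  choose b hb using fun i ↦ hsurjB (g (MvPolynomial.X i))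
  let P := MvPolynomial (Fin n) R
  let Q := MvPolynomial (Fin n) k
  let _ : Algebra P B := (MvPolynomial.aeval b).toRingHom.toAlgebra
  have : IsScalarTower R P B := .of_algebraMap_eq fun r ↦ ((MvPolynomial.aeval b).commutes r).symm
  let _ : Algebra P Q := (MvPolynomial.map (residue R)).toAlgebra
  have : IsScalarTower R P Q := .of_algebraMap_eq fun r ↦ (MvPolynomial.map_C _ r).symm
  have : IsScalarTower R k Q := inferInstance
  have : Algebra.FinitePresentation P B := .of_restrict_scalars_finitePresentation R P B
  have hsurj : Function.Surjective (algebraMap P Q) :=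
    MvPolynomial.map_surjective _ residue_surjective
  have hker : RingHom.ker (algebraMap P Q) = (maximalIdeal R).map (algebraMap R P) := by
    rw [← ker_residue]
    exact MvPolynomial.ker_map _
  have hX (i : Fin n) : algebraMap P B (MvPolynomial.X i) = b i := MvPolynomial.aeval_X _ _
  have hXQ (i : Fin n) : algebraMap P Q (MvPolynomial.X i) = MvPolynomial.X i :=
    MvPolynomial.map_X _ _
  let N := Q ⊗[P] B
  -- `N` is the closed fibre again. The surjection `ψ` carries over finiteness over `Q`; the map `ρ`
  -- back to `B₀` carries over injectivity.
  let ψ : B₀ →ₐ[k] N := Algebra.TensorProduct.lift (Algebra.ofId k N)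
    ((Algebra.TensorProduct.includeRight : B →ₐ[P] N).restrictScalars R) fun _ _ ↦ .all _ _
  have hψg (f : Q) : ψ (g f) = algebraMap Q N f := by
    have : ψ.comp g = IsScalarTower.toAlgHom k Q N := by
      refine MvPolynomial.algHom_ext fun i ↦ ?_
      change ψ (g (MvPolynomial.X i)) = MvPolynomial.X i ⊗ₜ 1
      rw [← hb]
      change (1 : N) * (1 ⊗ₜ b i) = _
      rw [one_mul, ← hX, ← hXQ, Algebra.algebraMap_eq_smul_one, Algebra.algebraMap_eq_smul_one,
        TensorProduct.smul_tmul]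
    exact DFunLike.congr_fun this f
  have hψ : Function.Surjective ψ := by
    intro y
    obtain ⟨y, rfl⟩ := Algebra.TensorProduct.includeRight_surjective B hsurj y
    exact ⟨1 ⊗ₜ y, one_mul _⟩
  have : Module.Finite Q N := by
    let _ : Algebra Q B₀ := g.toRingHom.toAlgebra
    have : Module.Finite Q B₀ := hgfin
    exact Module.Finite.of_surjective
      (⟨⟨ψ, map_add ψ⟩, fun f y ↦ by
        change ψ (g f * y) = f • ψ y
        rw [map_mul, hψg]
        exact (Algebra.smul_def f (ψ y)).symm⟩ : B₀ →ₗ[Q] N) hψ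
  have hinj : Function.Injective (algebraMap Q N) := by
    let j : B →ₐ[R] B₀ := Algebra.TensorProduct.includeRight
    let _ : Algebra P B₀ := (j.toRingHom.comp (algebraMap P B)).toAlgebra
    let g' : Q →ₐ[P] B₀ := AlgHom.mk g.toRingHom fun y ↦ by
      change (g.toRingHom.comp (algebraMap P Q)) y = (j.toRingHom.comp (algebraMap P B)) y
      congr 1
      refine MvPolynomial.ringHom_ext (fun r ↦ ?_) fun i ↦ ?_
      · change g (algebraMap P Q (algebraMap R P r)) = j (algebraMap P B (algebraMap R P r))
        rw [← IsScalarTower.algebraMap_apply, ← IsScalarTower.algebraMap_apply, j.commutes,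
          IsScalarTower.algebraMap_apply R k Q, g.commutes]
        rfl
      · change g (algebraMap P Q (MvPolynomial.X i)) = j (algebraMap P B (MvPolynomial.X i))
        rw [hX, hXQ]
        exact (hb i).symm
    let ι : B →ₐ[P] B₀ := AlgHom.mk j.toRingHom fun _ ↦ rfl
    let ρ : N →ₐ[P] B₀ := Algebra.TensorProduct.lift g' ι fun _ _ ↦ .all _ _
    refine Function.Injective.of_comp (f := ρ) ?_
    have : ρ ∘ algebraMap Q N = g := by
      funext f
      change g f * j 1 = g f
      rw [map_one, mul_one]
    rwa [this]
  obtain ⟨c, hc⟩ := exists_mem_freeLocus_of_infinite (k := k) (n := n) N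
  choose c' hc' using fun i ↦ residue_surjective (c i)
  let x : PrimeSpectrum Q := ⟨RingHom.ker (MvPolynomial.eval c), RingHom.ker_isPrime _⟩
  -- Evaluation at a lift of `c`: its closed point is the rational point where the closed fibre is
  -- free.
  let _ : Algebra P R := (MvPolynomial.aeval c').toRingHom.toAlgebra
  have hS : (maximalIdeal R).comap (algebraMap P R) = x.asIdeal.comap (algebraMap P Q) := by
    have h : (residue R).comp (algebraMap P R) =
        (MvPolynomial.eval c).comp (algebraMap P Q) := by
      refine MvPolynomial.ringHom_ext (fun r ↦ ?_) fun i ↦ ?_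
      · change residue R (MvPolynomial.aeval c' (MvPolynomial.C r)) =
          MvPolynomial.eval c (MvPolynomial.map (residue R) (MvPolynomial.C r))
        simp
      · change residue R (MvPolynomial.aeval c' (MvPolynomial.X i)) =
          MvPolynomial.eval c (MvPolynomial.map (residue R) (MvPolynomial.X i))
        simp [hc']
    change _ = (RingHom.ker (MvPolynomial.eval c)).comap (algebraMap P Q)
    rw [RingHom.comap_ker, ← h, ← RingHom.comap_ker, ker_residue]
  obtain ⟨C, _, _, h₁, h₂, h₃, h₄, f, hf⟩ := exists_finite_free_of_finite_fibre (R := R) (P := P)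
    (B := B) (Q := Q) (S := R) hsurj hker hinj x (hc x rfl) hS
  refine ⟨C, _, _, h₁, h₂, h₃, h₄, ⟨{ f with commutes' := fun r ↦ ?_ }⟩⟩
  change f (algebraMap R B r) = _
  rw [IsScalarTower.algebraMap_apply R P B, hf]
  congr 1
  exact (MvPolynomial.aeval c').commutes r

end Slice

/-! ### Descent of fppf algebras to an earlier ring. -/

section Descent

/-- An fppf algebra over a faithfully flat `R`-algebra `S` descends to an fppf algebra over `R` as
soon as the coefficients of a finite presentation come from `R`. -/
theorem exists_isFppf_model {R S B : Type u} [CommRing R] [CommRing S] [CommRing B] [Algebra R S]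
    [Module.FaithfullyFlat R S] [Algebra S B] (hB : IsFppf S B) {m n : ℕ}
    (P : Algebra.Presentation S B (Fin m) (Fin n))
    (hP : P.coeffs ⊆ Set.range (algebraMap R S)) :
    ∃ (M : Type u) (_ : CommRing M) (_ : Algebra R M),
      IsFppf R M ∧ Nonempty (S ⊗[R] M ≃ₐ[S] B) := by
  have := hB.faithfullyFlat
  let _ : Algebra R B := ((algebraMap S B).comp (algebraMap R S)).toAlgebra
  have : IsScalarTower R S B := .of_algebraMap_eq fun _ ↦ rfl
  have : P.HasCoeffs R := ⟨hP⟩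
  let M := P.ModelOfHasCoeffs R
  let e : S ⊗[R] M ≃ₐ[S] B := P.tensorModelOfHasCoeffsEquiv R
  have : Module.Flat S (S ⊗[R] M) := Module.Flat.of_linearEquiv e.toLinearEquiv
  have : Module.Flat R M := Module.Flat.of_flat_tensorProduct R M S
  have hM : Module.FaithfullyFlat R M := by
    -- Flatness of `M` descends along R → S. For surjectivity on spectra, Spec B → Spec R is onto
    -- and factors through Spec M.
    let j : M →ₐ[R] B := (e.toAlgHom.restrictScalars R).comp Algebra.TensorProduct.includeRight
    have : Module.FaithfullyFlat R B := Module.FaithfullyFlat.trans R S B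
    refine Module.FaithfullyFlat.of_comap_surjective fun x ↦ ?_
    obtain ⟨y, rfl⟩ := PrimeSpectrum.comap_surjective_of_faithfullyFlat (A := R) (B := B) x
    refine ⟨PrimeSpectrum.comap j.toRingHom y, ?_⟩
    rw [← PrimeSpectrum.comap_comp_apply]
    congr 1
    exact j.comp_algebraMap
  exact ⟨M, inferInstance, inferInstance, ⟨hM, inferInstance⟩, ⟨e⟩⟩

/-- Every fppf algebra over a strictly local ring `R` maps to `R₊`. -/
theorem nonempty_algHom_plus {R B : Type u} [CommRing R] [IsStrictlyLocal R] [CommRing B]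
    [Algebra R B] (hB : IsFppf R B) : Nonempty (B →ₐ[R] Plus R) := by
  obtain ⟨C, _, _, _, _, _, _, ⟨f⟩⟩ := exists_algHom_finite_free hB
  obtain ⟨e, he⟩ := exists_isConnectedFiniteFppf (R := R) (A := C)
  obtain ⟨i, ⟨g⟩, -⟩ := existsUnique_idx R _ he
  exact ⟨i.toPlus.comp (g.toAlgHom.comp ((IsScalarTower.toAlgHom R C _).comp f))⟩

/-- Since B ≅ S ⊗ M with `M` fppf over `R`, a retraction is an `R`-map M → S, and M → R₊ → S is one.
In the tower, `R` is a stage before the limit `S`. -/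
theorem nonempty_retraction_of_plus {R S B : Type u} [CommRing R] [IsStrictlyLocal R] [CommRing S]
    [CommRing B] [Algebra R S] [Module.FaithfullyFlat R S] [Algebra S B] (hB : IsFppf S B) {m n : ℕ}
    (P : Algebra.Presentation S B (Fin m) (Fin n))
    (hP : P.coeffs ⊆ Set.range (algebraMap R S)) (f : Plus R →ₐ[R] S) :
    Nonempty (B →ₐ[S] S) := by
  obtain ⟨M, _, _, hM, ⟨e⟩⟩ := exists_isFppf_model hB P hP
  obtain ⟨g⟩ := nonempty_algHom_plus hM
  exact ⟨(Algebra.TensorProduct.lift (AlgHom.id S S) (f.comp g) fun _ _ ↦ .all _ _).comp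
    e.symm.toAlgHom⟩

end Descent

/-! ### Elements of the rings at limit ordinals. -/

section Tower

open CategoryTheory CategoryTheory.Limits

variable (R : Type u) [CommRing R]

lemma transition_self (ν : Ordinal.{u}) : transition R (le_refl ν) = RingHom.id _ :=
  congrArg CommRingCat.Hom.hom ((tower R).map_id ν)

lemma transition_comp {α β γ : Ordinal.{u}} (h : α ≤ β) (h' : β ≤ γ) :
    (transition R h').comp (transition R h) = transition R (h.trans h') :=
  (congrArg CommRingCat.Hom.hom ((tower R).map_comp (homOfLE h) (homOfLE h'))).symm

lemma transition_transition {α β γ : Ordinal.{u}} (h : α ≤ β) (h' : β ≤ γ) (x : stage R α) :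
    transition R h' (transition R h x) = transition R (h.trans h') x :=
  DFunLike.congr_fun (transition_comp R h h') x

lemma isFiltered_Iio_of_isSuccLimit {ν : Ordinal.{u}} (hν : Order.IsSuccLimit ν) :
    IsFiltered (Set.Iio ν) :=
  have : Nonempty (Set.Iio ν) := ⟨⟨⊥, hν.bot_lt⟩⟩
  inferInstance

/-- Filtered colimits of rings are computed on sets. The ordinals below ν live one universe higher,
hence the passage to a small model. -/
lemma preservesColimitsOfShape_Iio {ν : Ordinal.{u}} (hν : Order.IsSuccLimit ν) :
    PreservesColimitsOfShape (Set.Iio ν) (forget CommRingCat.{u}) := by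
  have := isFiltered_Iio_of_isSuccLimit hν
  have : IsFiltered (SmallModel.{u} (Set.Iio ν)) :=
    IsFiltered.of_equivalence (equivSmallModel.{u} (Set.Iio ν))
  exact preservesColimitsOfShape_of_equiv (equivSmallModel.{u} (Set.Iio ν)).symm _

/-- Every element of `R_ν`, for a limit ordinal `ν`, comes from an earlier ring. -/
lemma exists_transition_eq {ν : Ordinal.{u}} (hν : Order.IsSuccLimit ν) (x : stage R ν) :
    ∃ (γ : Ordinal.{u}) (h : γ < ν) (y : stage R γ), transition R h.le y = x := by
  obtain ⟨hc⟩ := tower_limit R ν hν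
  have := preservesColimitsOfShape_Iio hν
  obtain ⟨γ, y, hy⟩ := Types.jointly_surjective_of_isColimit
    (isColimitOfPreserves (forget CommRingCat.{u}) hc) x
  exact ⟨γ.1, γ.2, y, hy⟩

/-- Elements with the same image in `R_ν`, for a limit ordinal `ν`, agree at an earlier stage. -/
lemma exists_transition_eq_transition {γ ν : Ordinal.{u}} (hν : Order.IsSuccLimit ν) (h : γ < ν)
    {x y : stage R γ} (hxy : transition R h.le x = transition R h.le y) :
    ∃ (δ : Ordinal.{u}) (hδ : γ ≤ δ), δ < ν ∧ transition R hδ x = transition R hδ y := by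
  obtain ⟨hc⟩ := tower_limit R ν hν
  have := preservesColimitsOfShape_Iio hν
  have := isFiltered_Iio_of_isSuccLimit hν
  obtain ⟨δ, f, hf⟩ := (Types.FilteredColimit.isColimit_eq_iff'
    (isColimitOfPreserves (forget CommRingCat.{u}) hc) (i := ⟨γ, h⟩) x y).mp hxy
  exact ⟨δ.1, leOfHom f, δ.2, hf⟩

end Tower

/-! ### Transfinite induction and fppf-locality at limits. -/

section Transfinite

open CategoryTheory

variable (R : Type u) [CommRing R]

lemma isStrictlyLocal_of_eq {A : CommRingCat.{u}} {B : Type u} [CommRing B]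
    (h : A = CommRingCat.of B) [IsStrictlyLocal B] : IsStrictlyLocal A := by
  subst h
  assumption

lemma isIntegral_and_flat_transition_succ (γ : Ordinal.{u}) [IsLocalRing (stage R γ)] :
    (transition R (Order.le_succ γ)).IsIntegral ∧ (transition R (Order.le_succ γ)).Flat := by
  obtain ⟨e, he⟩ := tower_succ R γ
  have h : transition R (Order.le_succ γ) =
      (e.commRingCatIsoToRingEquiv.symm : Plus (stage R γ) →+* stage R (Order.succ γ)).comp
        (algebraMap (stage R γ) (Plus (stage R γ))) :=
    congrArg CommRingCat.Hom.hom ((Iso.eq_comp_inv e).mpr he)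
  rw [h]
  have hb := e.commRingCatIsoToRingEquiv.symm.bijective
  exact ⟨RingHom.IsIntegral.trans _ _ (algebraMap_isIntegral_iff.mpr inferInstance)
      (RingHom.isIntegral_of_surjective _ hb.2),
    (RingHom.flat_algebraMap_iff.mpr inferInstance).comp (RingHom.Flat.of_bijective hb)⟩

lemma exists_ringHom_plus_stage (γ : Ordinal.{u}) :
    ∃ f : Plus (stage R γ) →+* stage R (Order.succ γ),
      f.comp (algebraMap (stage R γ) (Plus (stage R γ))) = transition R (Order.le_succ γ) := by
  obtain ⟨e, he⟩ := tower_succ R γ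
  exact ⟨e.inv.hom, (congrArg CommRingCat.Hom.hom ((Iso.eq_comp_inv e).mpr he)).symm⟩

lemma isStrictlyLocal_stage_succ (γ : Ordinal.{u}) [IsStrictlyLocal (stage R γ)] :
    IsStrictlyLocal (stage R (Order.succ γ)) := by
  obtain ⟨e, -⟩ := tower_succ R γ
  have : IsLocalRing (stage R (Order.succ γ)) :=
    e.commRingCatIsoToRingEquiv.symm.isLocalRing
  let _ : Algebra (stage R γ) (stage R (Order.succ γ)) :=
    (transition R (Order.le_succ γ)).toAlgebra
  have : Algebra.IsIntegral (stage R γ) (stage R (Order.succ γ)) :=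
    ⟨(isIntegral_and_flat_transition_succ R γ).1⟩
  exact isStrictlyLocal_of_isIntegral (stage R γ) _

variable {R}

lemma isLocalRing_stage_of_isSuccLimit {ν : Ordinal.{u}} (hν : Order.IsSuccLimit ν)
    (h : ∀ γ < ν, IsLocalRing (stage R γ)) : IsLocalRing (stage R ν) := by
  have : Nontrivial (stage R ν) := by
    refine ⟨1, 0, fun h10 ↦ ?_⟩
    obtain ⟨δ, hδ, hδν, h10⟩ := exists_transition_eq_transition R hν hν.bot_lt
      (x := 1) (y := 0) (by rw [map_one, map_zero, h10])
    have := h δ hδν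
    rw [map_one, map_zero] at h10
    exact one_ne_zero h10
  refine IsLocalRing.of_isUnit_or_isUnit_one_sub_self fun x ↦ ?_
  obtain ⟨γ, hγ, x, rfl⟩ := exists_transition_eq R hν x
  have := h γ hγ
  rw [← map_one (transition R hγ.le), ← map_sub]
  exact (IsLocalRing.isUnit_or_isUnit_one_sub_self x).imp (·.map _) (·.map _)

lemma isIntegral_transition_of_isSuccLimit {γ ν : Ordinal.{u}} (hν : Order.IsSuccLimit ν)
    (hγ : γ < ν) (h : ∀ δ (hδ : γ ≤ δ), δ < ν → (transition R hδ).IsIntegral) :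
    (transition R hγ.le).IsIntegral := by
  intro x
  obtain ⟨δ, hδ, x, rfl⟩ := exists_transition_eq R hν x
  have hm : max γ δ < ν := max_lt hγ hδ
  obtain ⟨p, hp, hpx⟩ := h _ (le_max_left γ δ) hm (transition R (le_max_right γ δ) x)
  refine ⟨p, hp, ?_⟩
  rw [← transition_transition R (le_max_right γ δ) hm.le,
    ← transition_comp R (le_max_left γ δ) hm.le, ← Polynomial.hom_eval₂, hpx, map_zero]

lemma flat_transition_of_isSuccLimit {γ ν : Ordinal.{u}} (hν : Order.IsSuccLimit ν)
    (hγ : γ < ν) (h : ∀ δ (hδ : γ ≤ δ), δ < ν → (transition R hδ).Flat) :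
    (transition R hγ.le).Flat := by
  let _ (i : Set.Ico γ ν) : Algebra (stage R γ) (stage R i.1) := (transition R i.2.1).toAlgebra
  let _ : Algebra (stage R γ) (stage R ν) := (transition R hγ.le).toAlgebra
  have (i : Set.Ico γ ν) : Module.Flat (stage R γ) (stage R i.1) := h i.1 i.2.1 i.2.2
  have : Nonempty (Set.Ico γ ν) := ⟨⟨γ, le_rfl, hγ⟩⟩
  let g (i : Set.Ico γ ν) : stage R i.1 →ₐ[stage R γ] stage R ν :=
    AlgHom.mk (transition R i.2.2.le) fun r ↦ transition_transition R i.2.1 i.2.2.le r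
  let t (i j : Set.Ico γ ν) (hij : i ≤ j) : stage R i.1 →ₐ[stage R γ] stage R j.1 :=
    AlgHom.mk (transition R hij) fun r ↦ transition_transition R i.2.1 hij r
  change Module.Flat (stage R γ) (stage R ν)
  refine flat_of_directed (fun i : Set.Ico γ ν ↦ stage R i.1) (fun i ↦ (g i).toLinearMap)
    (fun i j hij ↦ (t i j hij).toLinearMap)
    (fun i j hij x ↦ transition_transition R hij j.2.2.le x) (fun s ↦ ?_) fun i x hx ↦ ?_
  · obtain ⟨δ, hδ, x, rfl⟩ := exists_transition_eq R hν s
    have hm : max γ δ < ν := max_lt hγ hδ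
    exact ⟨⟨max γ δ, le_max_left _ _, hm⟩, transition R (le_max_right γ δ) x,
      transition_transition R _ _ x⟩
  · obtain ⟨δ, hδ, hδν, hx⟩ := exists_transition_eq_transition R hν i.2.2 (x := x) (y := 0)
      (hx.trans (map_zero (transition R i.2.2.le)).symm)
    exact ⟨⟨δ, i.2.1.trans hδ, hδν⟩, hδ, hx.trans (map_zero _)⟩

variable (R)

/-- The properties are proved jointly: the successor step needs the previous ring strictly local,
and strict locality at a limit is deduced from integrality over the initial ring. -/
theorem isStrictlyLocal_stage_and_transition [IsStrictlyLocal R] (ν : Ordinal.{u}) :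
    IsStrictlyLocal (stage R ν) ∧ ∀ γ (h : γ ≤ ν),
      (transition R h).IsIntegral ∧ (transition R h).Flat := by
  have self (ν : Ordinal.{u}) :
      (transition R (le_refl ν)).IsIntegral ∧ (transition R (le_refl ν)).Flat := by
    rw [transition_self]
    exact ⟨RingHom.isIntegral_of_surjective _ Function.surjective_id, RingHom.Flat.id _⟩
  induction ν using Ordinal.limitRecOn with
  | zero =>
    refine ⟨isStrictlyLocal_of_eq (tower_zero R), fun γ h ↦ ?_⟩
    obtain rfl : γ = 0 := nonpos_iff_eq_zero.mp h
    exact self 0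
  | add_one ν ih =>
    rw [← Order.succ_eq_add_one]
    have := ih.1
    refine ⟨isStrictlyLocal_stage_succ R ν, fun γ h ↦ ?_⟩
    rcases h.lt_or_eq with hlt | rfl
    · have hle := Order.lt_succ_iff.mp hlt
      have h₁ := ih.2 γ hle
      have h₂ := isIntegral_and_flat_transition_succ R ν
      rw [← transition_comp R hle (Order.le_succ ν)]
      exact ⟨h₁.1.trans _ _ h₂.1, h₁.2.comp h₂.2⟩
    · exact self _
  | limit ν hν ih =>
    have main (γ : Ordinal.{u}) (h : γ ≤ ν) :
        (transition R h).IsIntegral ∧ (transition R h).Flat := by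
      rcases h.lt_or_eq with hlt | rfl
      · exact ⟨isIntegral_transition_of_isSuccLimit hν hlt fun δ hδ hδν ↦ ((ih δ hδν).2 γ hδ).1,
          flat_transition_of_isSuccLimit hν hlt fun δ hδ hδν ↦ ((ih δ hδν).2 γ hδ).2⟩
      · exact self _
    refine ⟨?_, main⟩
    have := isLocalRing_stage_of_isSuccLimit hν fun γ hγ ↦ (ih γ hγ).1.toIsLocalRing
    have := (ih ⊥ hν.bot_lt).1
    let _ : Algebra (stage R ⊥) (stage R ν) := (transition R bot_le).toAlgebra
    have : Algebra.IsIntegral (stage R ⊥) (stage R ν) := ⟨(main ⊥ bot_le).1⟩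
    exact isStrictlyLocal_of_isIntegral (stage R ⊥) _

theorem isStrictlyLocal_stage [IsStrictlyLocal R] (ν : Ordinal.{u}) :
    IsStrictlyLocal (stage R ν) :=
  (isStrictlyLocal_stage_and_transition R ν).1

theorem isLocalHom_transition [IsStrictlyLocal R] {γ ν : Ordinal.{u}} (h : γ ≤ ν) :
    IsLocalHom (transition R h) := by
  have := isStrictlyLocal_stage R γ
  have := isStrictlyLocal_stage R ν
  let _ : Algebra (stage R γ) (stage R ν) := (transition R h).toAlgebra
  have : Algebra.IsIntegral (stage R γ) (stage R ν) :=
    ⟨((isStrictlyLocal_stage_and_transition R ν).2 γ h).1⟩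
  exact isLocalHom_algebraMap_of_isIntegral (stage R γ) (stage R ν)

theorem faithfullyFlat_transition [IsStrictlyLocal R] {γ ν : Ordinal.{u}} (h : γ ≤ ν) :
    (transition R h).FaithfullyFlat := by
  have := isStrictlyLocal_stage R γ
  have := isStrictlyLocal_stage R ν
  let _ : Algebra (stage R γ) (stage R ν) := (transition R h).toAlgebra
  have : Module.Flat (stage R γ) (stage R ν) :=
    ((isStrictlyLocal_stage_and_transition R ν).2 γ h).2
  have : IsLocalHom (algebraMap (stage R γ) (stage R ν)) := isLocalHom_transition R h
  exact Module.FaithfullyFlat.of_flat_of_isLocalHom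

/-- A finite subset of `R_ν`, for a limit ordinal `ν`, comes from an earlier ring. -/
lemma exists_subset_range_transition {ν : Ordinal.{u}} (hν : Order.IsSuccLimit ν)
    {s : Set (stage R ν)} (hs : s.Finite) :
    ∃ (γ : Ordinal.{u}) (h : γ < ν), s ⊆ Set.range (transition R h.le) := by
  induction s, hs using Set.Finite.induction_on with
  | empty => exact ⟨⊥, hν.bot_lt, Set.empty_subset _⟩
  | @insert x s _ _ ih =>
    obtain ⟨γ, hγ, hs⟩ := ih
    obtain ⟨δ, hδ, x, rfl⟩ := exists_transition_eq R hν x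
    have hm : max γ δ < ν := max_lt hγ hδ
    refine ⟨max γ δ, hm, Set.insert_subset ⟨_, transition_transition R (le_max_right γ δ) hm.le x⟩
      (hs.trans ?_)⟩
    rintro _ ⟨y, rfl⟩
    exact ⟨_, transition_transition R (le_max_left γ δ) hm.le y⟩

/-- For a limit ordinal `ν`, the ring `R_ν` is fppf-local. -/
theorem isFppfLocal_stage_of_isSuccLimit [IsStrictlyLocal R] {ν : Ordinal.{u}}
    (hν : Order.IsSuccLimit ν) : IsFppfLocal (stage R ν) := by
  refine ⟨(isStrictlyLocal_stage R ν).toIsLocalRing, fun B _ _ hB ↦ ?_⟩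
  have := hB.finitePresentation
  obtain ⟨m, n, ⟨P⟩⟩ := Algebra.Presentation.exists_presentation_fin (stage R ν) B
  obtain ⟨γ, hγ, hP⟩ := exists_subset_range_transition R hν P.finite_coeffs
  have := isStrictlyLocal_stage R γ
  let _ : Algebra (stage R γ) (stage R ν) := (transition R hγ.le).toAlgebra
  have : Module.FaithfullyFlat (stage R γ) (stage R ν) := faithfullyFlat_transition R hγ.le
  obtain ⟨f, hf⟩ := exists_ringHom_plus_stage R γ
  -- The limit hypothesis again: one more step of the tower, which adjoins the points of the
  -- descended algebra, stays below `ν`.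
  have hγ' : Order.succ γ < ν := hν.succ_lt hγ
  let f' : Plus (stage R γ) →ₐ[stage R γ] stage R ν :=
    AlgHom.mk ((transition R hγ'.le).comp f) fun r ↦ by
      change transition R hγ'.le ((f.comp (algebraMap _ _)) r) = transition R hγ.le r
      rw [hf, transition_transition]
  exact nonempty_retraction_of_plus hB P hP f'

end Transfinite

end FppfTower

/-- Let `R` be a strictly local ring with its tower `R_ν`, indexed by the ordinals of the universe
of `R`. All `R_ν` are strictly local, all transition maps are local, faithfully flat and integral,
and `R_ν` is fppf-local for each limit ordinal `ν` (in particular `ν ≠ 0`). -/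
theorem mainTheorem7 (R : Type u) [CommRing R] [FppfTower.IsStrictlyLocal R] :
    (∀ ν : Ordinal.{u}, FppfTower.IsStrictlyLocal (FppfTower.stage R ν)) ∧
    (∀ (γ ν : Ordinal.{u}) (h : γ ≤ ν),
      IsLocalHom (FppfTower.transition R h) ∧
      (FppfTower.transition R h).FaithfullyFlat ∧
      (FppfTower.transition R h).IsIntegral) ∧
    (∀ ν : Ordinal.{u}, Order.IsSuccLimit ν → FppfTower.IsFppfLocal (FppfTower.stage R ν)) :=
  ⟨FppfTower.isStrictlyLocal_stage R,
    fun γ ν h ↦ ⟨FppfTower.isLocalHom_transition R h, FppfTower.faithfullyFlat_transition R h,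
      ((FppfTower.isStrictlyLocal_stage_and_transition R ν).2 γ h).1⟩,
    fun _ hν ↦ FppfTower.isFppfLocal_stage_of_isSuccLimit R hν⟩
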